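/- For a convex polyhedron $P\subseteq\mathbb R^2$ (a finite intersection of closed half-planes) let $[P]:\mathbb R^2\to\mathbb C$ be its indicator function. The Minkowski ring $M$ of closed convex polyhedra of $\mathbb R^2$ is the complex vector space of functions spanned by all the $[P]$, with the (well-defined) commutative multiplication determined by $[P]\cdot[Q]=[P+Q]$, where $P+Q$ is the Minkowski sum; its unit is $[\{(0,0)\}]$. For a set $\mathcal D$ of nonempty convex polytopes, $M^{\pm}(\mathcal D)\subseteq M$ denotes the $\mathbb C$-subalgebra generated by the $[P]$, $P\in\mathcal D$, and their multiplicative inverses. Let $O=(0,0)$, $A=(1,0)$, $B=(\tfrac12,\tfrac{\sqrt3}{2})$. Let $\mathcal A$ be the set of all closed convex polygons (points and segments included) on the triangular grid with sides of slope $0,\pm\sqrt3$, that is, the nonempty bounded sets that are finite intersections of closed half-planes bounded by lines $y=\ell\frac{\sqrt3}{2}$, $y=\sqrt3\,x+\ell\sqrt3$ or $y=-\sqrt3\,x+\ell\sqrt3$ with $\ell\in\mathbb Z$. Write $\llbracket\cdots\rrbracket$ for the convex hull. **Theorem.** We have $$M^{\pm}(\mathcal A)=M^{\pm}\bigl(\llbracket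 A\rrbracket,\llbracket B\rrbracket,\llbracket O,A\rrbracket,\llbracket O,B\rrbracket,\llbracket A,B\rrbracket,\llbracket O,A,B\rrbracket\bigr),$$ and there is an isomorphism of $\mathbb C$-algebras $$\mathbb C[x_1^{\pm1},x_2^{\pm1},y_1^{\pm1},y_2^{\pm1},y_3^{\pm1},z^{\pm1}]/I\;\cong\; M^{\pm}(\mathcal A)$$ that sends the classes of $x_1,x_2,y_1,y_2,y_3,z$ to the indicator functions of $\llbracket A\rrbracket,\llbracket B\rrbracket,\llbracket O,A\rrbracket,\llbracket O,B\rrbracket,\llbracket A,B\rrbracket,\llbracket O,A,B\rrbracket$ respectively, where $I$ is the ideal generated by $G_1\cup G_2$ with $$G_1=\{(y_1-1)(y_1-x_1),\ (y_2-1)(y_2-x_2),\ (y_3-x_1)(y_3-x_2)\},$$ $$G_2=\{(z-1)(z-y_3),\ (z-x_1)(z-y_2),\ (z-x_2)(z-y_1),\ (z-y_1)(z-y_2),\ (z-y_1)(z-y_3),\ (z-y_2)(z-y_3)\}.$$ -/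

import Mathlib

open scoped Pointwise

noncomputable section

/-! ## Closed convex polyhedra -/

/-- A closed convex polyhedron: the intersection of finitely many closed half-spaces
`{x | ℓ x ≤ b}`. -/
def IsPolyhedron {V : Type*} [AddCommGroup V] [Module ℝ V] (S : Set V) : Prop :=
  ∃ s : Set (Module.Dual ℝ V × ℝ), s.Finite ∧ S = {x | ∀ p ∈ s, p.1 x ≤ p.2}

theorem IsPolyhedron.inter {V : Type*} [AddCommGroup V] [Module ℝ V] {S T : Set V}
    (hS : IsPolyhedron S) (hT : IsPolyhedron T) : IsPolyhedron (S ∩ T) := by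
  obtain ⟨s, hs, rfl⟩ := hS
  obtain ⟨t, ht, rfl⟩ := hT
  refine ⟨s ∪ t, hs.union ht, ?_⟩
  ext x
  simp only [Set.mem_inter_iff, Set.mem_ofPred_eq, Set.mem_union]
  exact ⟨fun h p hp => hp.elim (h.1 p) (h.2 p),
    fun h => ⟨fun p hp => h p (Or.inl hp), fun p hp => h p (Or.inr hp)⟩⟩

theorem IsPolyhedron.iInter {V ι : Type*} [AddCommGroup V] [Module ℝ V] [Finite ι]
    {S : ι → Set V} (hS : ∀ i, IsPolyhedron (S i)) : IsPolyhedron {x | ∀ i, x ∈ S i} := by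
  choose s hs h using hS
  refine ⟨⋃ i, s i, Set.finite_iUnion hs, ?_⟩
  ext x
  simp only [Set.mem_ofPred_eq, Set.mem_iUnion]
  constructor
  · rintro hx p ⟨i, hp⟩
    have := hx i
    rw [h i] at this
    exact this p hp
  · intro hx i
    rw [h i]
    exact fun p hp => hx p ⟨i, hp⟩

theorem isPolyhedron_le {V : Type*} [AddCommGroup V] [Module ℝ V]
    (f : Module.Dual ℝ V) (b : ℝ) : IsPolyhedron {x | f x ≤ b} :=
  ⟨{(f, b)}, Set.finite_singleton _, by ext; simp⟩

theorem isPolyhedron_eq {V : Type*} [AddCommGroup V] [Module ℝ V]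
    (f : Module.Dual ℝ V) (b : ℝ) : IsPolyhedron {x | f x = b} := by
  have h := (isPolyhedron_le f b).inter (isPolyhedron_le (-f) (-b))
  convert h using 1
  ext x
  simp [le_antisymm_iff]

/-- The preimage of a polyhedron under an affine map is a polyhedron. -/
theorem IsPolyhedron.preimage {V U : Type*} [AddCommGroup V] [Module ℝ V] [AddCommGroup U]
    [Module ℝ U] {S : Set V} (hS : IsPolyhedron S) (f : U →ₗ[ℝ] V) :
    IsPolyhedron {x | f x ∈ S} := by
  obtain ⟨s, hs, rfl⟩ := hS
  refine ⟨(fun p => (p.1 ∘ₗ f, p.2)) '' s, hs.image _, ?_⟩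
  ext x
  simp only [Set.mem_ofPred_eq, Set.forall_mem_image, LinearMap.comp_apply]

/-- Elimination of one variable. -/
theorem IsPolyhedron.saturate {V : Type*} [AddCommGroup V] [Module ℝ V] {S : Set V}
    (hS : IsPolyhedron S) (v : V) : IsPolyhedron {x | ∃ t : ℝ, x + t • v ∈ S} := by
  obtain ⟨s, hs, rfl⟩ := hS
  refine ⟨{p ∈ s | p.1 v = 0} ∪ (fun q : (Module.Dual ℝ V × ℝ) × (Module.Dual ℝ V × ℝ) =>
      (q.1.1 v • q.2.1 - q.2.1 v • q.1.1, q.1.1 v * q.2.2 - q.2.1 v * q.1.2)) ''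
      ({p ∈ s | 0 < p.1 v} ×ˢ {p ∈ s | p.1 v < 0}),
    (hs.subset fun _ h => h.1).union
      (((hs.subset fun _ h => h.1).prod (hs.subset fun _ h => h.1)).image _), ?_⟩
  ext x
  simp only [Set.mem_ofPred_eq, map_add, map_smul, smul_eq_mul, Set.mem_union, Set.mem_image,
    Set.mem_prod, Prod.exists]
  constructor
  · rintro ⟨t, ht⟩ p (⟨hp, h0⟩ | ⟨a, b, a', b', ⟨⟨ha, ha0⟩, ⟨ha', ha0'⟩⟩, rfl⟩)
    · simpa [h0] using ht p hp
    · have h1 := ht _ ha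
      have h2 := ht _ ha'
      simp only at h1 h2 ha0 ha0'
      simp only [LinearMap.sub_apply, LinearMap.smul_apply, smul_eq_mul]
      nlinarith [mul_le_mul_of_nonneg_left h2 ha0.le,
        mul_le_mul_of_nonneg_left h1 (neg_nonneg.2 ha0'.le)]
  · intro h
    have key : ∀ p ∈ {p ∈ s | 0 < p.1 v}, ∀ q ∈ {p ∈ s | p.1 v < 0},
        (q.2 - q.1 x) / q.1 v ≤ (p.2 - p.1 x) / p.1 v := by
      rintro p ⟨hp, hp0⟩ q ⟨hq, hq0⟩
      have := h (p.1 v • q.1 - q.1 v • p.1, p.1 v * q.2 - q.1 v * p.2)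
        (Or.inr ⟨p.1, p.2, q.1, q.2, ⟨⟨hp, hp0⟩, ⟨hq, hq0⟩⟩, rfl⟩)
      simp only [LinearMap.sub_apply, LinearMap.smul_apply, smul_eq_mul] at this
      rw [div_le_iff_of_neg hq0, div_mul_eq_mul_div, div_le_iff₀ hp0]
      nlinarith
    have hex : ∃ t : ℝ, (∀ p ∈ {p ∈ s | 0 < p.1 v}, t ≤ (p.2 - p.1 x) / p.1 v) ∧
        ∀ q ∈ {p ∈ s | p.1 v < 0}, (q.2 - q.1 x) / q.1 v ≤ t := by
      rcases Set.eq_empty_or_nonempty {p ∈ s | p.1 v < 0} with he | hne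
      · rcases Set.eq_empty_or_nonempty {p ∈ s | 0 < p.1 v} with he' | hne'
        · exact ⟨0, by simp [he'], by simp [he]⟩
        · obtain ⟨p, hp, hmin⟩ := Set.exists_min_image _
            (fun p : Module.Dual ℝ V × ℝ => (p.2 - p.1 x) / p.1 v)
            (hs.subset fun _ h => h.1 : {p ∈ s | 0 < p.1 v}.Finite) hne'
          exact ⟨_, hmin, by simp [he]⟩
      · obtain ⟨q, hq, hmax⟩ := Set.exists_max_image _
            (fun p : Module.Dual ℝ V × ℝ => (p.2 - p.1 x) / p.1 v)
            (hs.subset fun _ h => h.1 : {p ∈ s | p.1 v < 0}.Finite) hne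
        exact ⟨_, fun p hp => key p hp q hq, hmax⟩
    obtain ⟨t, h1, h2⟩ := hex
    refine ⟨t, fun p hp => ?_⟩
    rcases lt_trichotomy (p.1 v) 0 with h0 | h0 | h0
    · have := h2 p ⟨hp, h0⟩
      rw [div_le_iff_of_neg h0] at this
      linarith
    · simpa [h0] using h p (Or.inl ⟨hp, h0⟩)
    · have := h1 p ⟨hp, h0⟩
      rw [le_div_iff₀ h0] at this
      linarith

theorem IsPolyhedron.saturate_finset {V ι : Type*} [AddCommGroup V] [Module ℝ V] {S : Set V}
    (hS : IsPolyhedron S) (s : Finset ι) (v : ι → V) :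
    IsPolyhedron {x | ∃ w : ι → ℝ, x + ∑ i ∈ s, w i • v i ∈ S} := by
  classical
  induction s using Finset.induction_on with
  | empty => simpa using hS
  | insert a s ha ih =>
    convert ih.saturate (v a) using 1
    ext x
    simp only [Set.mem_ofPred_eq, Finset.sum_insert ha]
    constructor
    · rintro ⟨w, hw⟩
      exact ⟨w a, w, by rwa [add_assoc]⟩
    · rintro ⟨t, w, hw⟩
      refine ⟨Function.update w a t, ?_⟩
      rw [Finset.sum_congr rfl (g := fun i => w i • v i)]
      · simpa [add_assoc] using hw
      · intro i hi
        rw [Function.update_of_ne]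
        rintro rfl
        exact ha hi

/-- The projection of a polyhedron is a polyhedron. -/
theorem IsPolyhedron.proj {V U : Type*} [AddCommGroup V] [Module ℝ V] [AddCommGroup U]
    [Module ℝ U] [FiniteDimensional ℝ U] {S : Set (V × U)} (hS : IsPolyhedron S) :
    IsPolyhedron {x | ∃ y, (x, y) ∈ S} := by
  have h := (hS.saturate_finset Finset.univ
    (fun i => ((0 : V), Module.finBasis ℝ U i))).preimage (LinearMap.inl ℝ V U)
  convert h using 1
  ext x
  have hs : ∀ w : Fin (Module.finrank ℝ U) → ℝ,
      LinearMap.inl ℝ V U x + ∑ i, w i • ((0 : V), Module.finBasis ℝ U i)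
        = (x, ∑ i, w i • Module.finBasis ℝ U i) := by
    intro w
    ext
    · simp [Prod.fst_sum]
    · simp [Prod.snd_sum]
  simp only [Set.mem_ofPred_eq, hs]
  constructor
  · rintro ⟨y, hy⟩
    exact ⟨(Module.finBasis ℝ U).repr y, by rwa [Module.Basis.sum_repr]⟩
  · rintro ⟨w, hw⟩
    exact ⟨_, hw⟩

theorem IsPolyhedron.add {V : Type*} [AddCommGroup V] [Module ℝ V] [FiniteDimensional ℝ V]
    {S T : Set V} (hS : IsPolyhedron S) (hT : IsPolyhedron T) : IsPolyhedron (S + T) := by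
  have h := ((hS.preimage (LinearMap.snd ℝ V V)).inter
    (hT.preimage (LinearMap.fst ℝ V V - LinearMap.snd ℝ V V))).proj
  convert h using 1
  ext x
  simp only [Set.mem_add, Set.mem_inter_iff, Set.mem_ofPred_eq, LinearMap.snd_apply,
    LinearMap.sub_apply, LinearMap.fst_apply]
  constructor
  · rintro ⟨a, ha, b, hb, rfl⟩
    exact ⟨a, ha, by simpa using hb⟩
  · rintro ⟨a, ha, hb⟩
    exact ⟨a, ha, _, hb, by simp⟩

/-- Convex polytopes are polyhedra. -/
theorem isPolyhedron_convexHull {V : Type*} [AddCommGroup V] [Module ℝ V]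
    [FiniteDimensional ℝ V] (s : Finset V) : IsPolyhedron (convexHull ℝ (s : Set V)) := by
  classical
  let b := Module.finBasis ℝ V
  let lin : (V × (s → ℝ)) →ₗ[ℝ] V :=
    LinearMap.fst ℝ V (s → ℝ) -
      (Fintype.linearCombination ℝ (fun i : s => (i : V))) ∘ₗ LinearMap.snd ℝ V (s → ℝ)
  have h := (((IsPolyhedron.iInter fun i : s => isPolyhedron_le
      (-(LinearMap.proj i ∘ₗ LinearMap.snd ℝ V (s → ℝ))) 0).inter
      (isPolyhedron_eq (∑ i : s, LinearMap.proj i ∘ₗ LinearMap.snd ℝ V (s → ℝ)) 1)).inter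
      (IsPolyhedron.iInter fun j => isPolyhedron_eq (b.coord j ∘ₗ lin) 0)).proj
  convert h using 1
  ext x
  have hlin : ∀ w : s → ℝ, (∀ j, (b.coord j) (lin (x, w)) = 0) ↔ x = ∑ i, w i • (i : V) := by
    intro w
    rw [b.forall_coord_eq_zero_iff]
    simp [lin, Fintype.linearCombination_apply, sub_eq_zero]
  simp only [Set.mem_inter_iff, Set.mem_ofPred_eq, LinearMap.comp_apply, hlin, LinearMap.neg_apply,
    LinearMap.snd_apply, LinearMap.proj_apply, LinearMap.sum_apply, neg_nonpos]
  rw [show (s : Set V) = Set.range (fun i : s => (i : V)) by simp,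
    convexHull_range_eq_exists_affineCombination]
  simp only [Set.mem_ofPred_eq]
  constructor
  · rintro ⟨t, w, hw, hw1, rfl⟩
    refine ⟨fun i => if i ∈ t then w i else 0, ⟨?_, ?_⟩, ?_⟩
    · intro i
      by_cases hi : i ∈ t <;> simp [hi, hw]
    · simpa only [Finset.sum_ite_mem, Finset.univ_inter] using hw1
    · rw [Finset.affineCombination_eq_linear_combination _ _ _ hw1]
      simp only [ite_smul, zero_smul, Finset.sum_ite_mem, Finset.univ_inter]
  · rintro ⟨w, ⟨hw, hw1⟩, rfl⟩
    exact ⟨Finset.univ, w, fun i _ => hw i, hw1,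
      Finset.affineCombination_eq_linear_combination _ _ _ hw1⟩

theorem IsPolyhedron.isClosed {V : Type*} [NormedAddCommGroup V] [NormedSpace ℝ V]
    [FiniteDimensional ℝ V] {S : Set V} (hS : IsPolyhedron S) : IsClosed S := by
  obtain ⟨s, -, rfl⟩ := hS
  simp only [Set.ofPred_forall]
  exact isClosed_biInter fun p _ =>
    isClosed_le p.1.continuous_of_finiteDimensional continuous_const

theorem IsPolyhedron.convex {V : Type*} [AddCommGroup V] [Module ℝ V] {S : Set V}
    (hS : IsPolyhedron S) : Convex ℝ S := by
  obtain ⟨s, -, rfl⟩ := hS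
  simp only [Set.ofPred_forall]
  exact convex_iInter₂ fun p _ => convex_halfSpace_le p.1.isLinear p.2

/-- The closed convex polyhedra of `ℝᵈ`, as a monoid under Minkowski addition. -/
def polyhedra (d : ℕ) : AddSubmonoid (Set (EuclideanSpace ℝ (Fin d))) where
  carrier := {S | IsPolyhedron S}
  zero_mem' := by
    have h := isPolyhedron_convexHull {(0 : EuclideanSpace ℝ (Fin d))}
    rw [Finset.coe_singleton, convexHull_singleton] at h
    exact h
  add_mem' hS hT := IsPolyhedron.add hS hT

/-- The convex hull of a finite set of points. -/
def polytope {d : ℕ} (s : Finset (EuclideanSpace ℝ (Fin d))) : polyhedra d :=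
  ⟨convexHull ℝ (s : Set (EuclideanSpace ℝ (Fin d))), isPolyhedron_convexHull s⟩

/-! ## The Minkowski ring -/

/-- The function `∑ c_P 1_P` on `ℝᵈ` attached to a formal linear combination `∑ c_P P` of
polyhedra. -/
def indicatorSum (d : ℕ) :
    AddMonoidAlgebra ℂ (polyhedra d) →ₗ[ℂ] (EuclideanSpace ℝ (Fin d) → ℂ) :=
  Finsupp.linearCombination ℂ
    (fun P : polyhedra d => (P : Set (EuclideanSpace ℝ (Fin d))).indicator (fun _ => (1 : ℂ)))
    ∘ₗ (AddMonoidAlgebra.coeffLinearEquiv ℂ).toLinearMap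

open Classical in
theorem sum_intervals_eq_zero {ι : Type*} (s : Finset ι) (c : ι → ℂ) (a b : ι → ℝ)
    (hab : ∀ i ∈ s, a i ≤ b i)
    (h : ∀ x, ∑ i ∈ s, c i * (if a i ≤ x ∧ x ≤ b i then 1 else 0) = 0) :
    ∑ i ∈ s, c i = 0 := by
  have hev : ∀ᶠ e : ℝ in nhdsWithin 0 (Set.Ioi 0), ∀ i ∈ s, ∀ j ∈ s,
      (b j < b i → e < b i - b j) ∧ (b j < a i → e < a i - b j) := by
    refine (Filter.eventually_all_finset s).2 fun i _ =>
      (Filter.eventually_all_finset s).2 fun j _ => ?_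
    have hlt : ∀ r : ℝ, ∀ᶠ e : ℝ in nhdsWithin 0 (Set.Ioi 0), 0 < r → e < r := by
      intro r
      by_cases hr : 0 < r
      · filter_upwards [Ioo_mem_nhdsGT hr] with e he _ using he.2
      · exact Filter.Eventually.of_forall fun _ h => absurd h hr
    filter_upwards [hlt (b i - b j), hlt (a i - b j)] with e h1 h2
    exact ⟨fun h => h1 (by linarith), fun h => h2 (by linarith)⟩
  obtain ⟨e, he, he0⟩ := (hev.and self_mem_nhdsWithin).exists
  have he0' : 0 < e := he0
  have hz : ∑ x ∈ s.image b, ∑ i ∈ s, c i *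
      ((if a i ≤ x ∧ x ≤ b i then 1 else 0) - (if a i ≤ x + e ∧ x + e ≤ b i then 1 else 0))
      = 0 := by
    refine Finset.sum_eq_zero fun x _ => ?_
    simp only [mul_sub, Finset.sum_sub_distrib, h, sub_zero]
  rw [Finset.sum_comm] at hz
  rw [← hz]
  refine Finset.sum_congr rfl fun i hi => ?_
  rw [← Finset.mul_sum]
  have : ∀ x ∈ s.image b, ((if a i ≤ x ∧ x ≤ b i then 1 else 0) -
      (if a i ≤ x + e ∧ x + e ≤ b i then 1 else 0) : ℂ) = if x = b i then 1 else 0 := by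
    intro x hx
    obtain ⟨j, hj, rfl⟩ := Finset.mem_image.1 hx
    obtain ⟨h1, h2⟩ := he i hi j hj
    have h3 := hab i hi
    rcases lt_trichotomy (b j) (b i) with h4 | h4 | h4
    · have h5 := h1 h4
      by_cases h6 : a i ≤ b j
      · rw [if_pos ⟨h6, h4.le⟩, if_pos ⟨by linarith, by linarith⟩, if_neg h4.ne, sub_self]
      · have h7 := h2 (not_le.1 h6)
        rw [if_neg (fun h => h6 h.1), if_neg (fun h => by linarith [h.1]), if_neg h4.ne, sub_self]
    · rw [if_pos ⟨by linarith, by linarith⟩, if_neg (fun h => by linarith [h.2]), if_pos h4,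
        sub_zero]
    · rw [if_neg (fun h => by linarith [h.2]), if_neg (fun h => by linarith [h.2]),
        if_neg h4.ne', sub_self]
  rw [Finset.sum_congr rfl this, Finset.sum_ite_eq', if_pos (Finset.mem_image_of_mem b hi),
    mul_one]

open Classical in
theorem sum_nonempty_of_slices {ι V : Type*} [NormedAddCommGroup V] [NormedSpace ℝ V]
    (s : Finset ι) (c : ι → ℂ) (K : ι → Set V) (hK : ∀ i, IsCompact (K i))
    (hK' : ∀ i, Convex ℝ (K i)) (f : V →L[ℝ] ℝ)
    (h : ∀ t : ℝ, ∑ i ∈ s, c i * (if (K i ∩ {p | f p = t}).Nonempty then 1 else 0) = 0) :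
    ∑ i ∈ s, c i * (if (K i).Nonempty then 1 else 0) = 0 := by
  have hI : ∀ i, ∃ a b : ℝ, (K i).Nonempty → a ≤ b ∧ f '' K i = Set.Icc a b := by
    intro i
    by_cases hi : (K i).Nonempty
    · have h1 := eq_Icc_of_connected_compact
        ⟨hi.image f, (hK' i).isPreconnected.image f f.continuous.continuousOn⟩ ((hK i).image f.continuous)
      refine ⟨_, _, fun _ => ⟨?_, h1⟩⟩
      have h2 := hi.image f
      rw [h1] at h2
      exact Set.nonempty_Icc.1 h2
    · exact ⟨0, 0, fun h => absurd h hi⟩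
  choose a b hab using hI
  simp only [mul_ite, mul_one, mul_zero, ← Finset.sum_filter]
  refine sum_intervals_eq_zero _ c a b
    (fun i hi => (hab i (Finset.mem_filter.1 hi).2).1) fun x => ?_
  rw [Finset.sum_filter]
  refine (Finset.sum_congr rfl fun i _ => ?_).trans (h x)
  by_cases hi : (K i).Nonempty
  · rw [if_pos hi]
    have : (a i ≤ x ∧ x ≤ b i) ↔ (K i ∩ {p | f p = x}).Nonempty := by
      rw [← Set.mem_Icc, ← (hab i hi).2]
      exact ⟨fun ⟨p, h1, h2⟩ => ⟨p, h1, h2⟩, fun ⟨p, h1, h2⟩ => ⟨p, h1, h2⟩⟩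
    simp only [this]
  · rw [if_neg hi, if_neg (fun h => hi (h.mono Set.inter_subset_left)), mul_zero]

open Classical in
/-- The Euler characteristic: if `∑ c_i 1_{C_i} = 0`, then the sum of the `c_i` with `C_i`
nonempty vanishes. -/
theorem sum_nonempty_eq_zero {ι : Type*} {d : ℕ} (s : Finset ι) (c : ι → ℂ)
    (C : ι → Set (EuclideanSpace ℝ (Fin d))) (hC : ∀ i, IsClosed (C i))
    (hC' : ∀ i, Convex ℝ (C i)) (h : ∀ x, ∑ i ∈ s, c i * (if x ∈ C i then 1 else 0) = 0) :
    ∑ i ∈ s, c i * (if (C i).Nonempty then 1 else 0) = 0 := by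
  have hR : ∃ R : ℝ, ∀ i ∈ s, (C i).Nonempty → (C i ∩ Metric.closedBall 0 R).Nonempty := by
    have : ∀ᶠ R : ℝ in Filter.atTop, ∀ i ∈ s, (C i).Nonempty →
        (C i ∩ Metric.closedBall 0 R).Nonempty := by
      refine (Filter.eventually_all_finset s).2 fun i _ => ?_
      by_cases hi : (C i).Nonempty
      · obtain ⟨p, hp⟩ := hi
        filter_upwards [Filter.eventually_ge_atTop ‖p‖] with R hR _
        exact ⟨p, hp, by simpa using hR⟩
      · exact Filter.Eventually.of_forall fun _ h => absurd h hi
    exact this.exists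
  obtain ⟨R, hR⟩ := hR
  have main : ∀ n : ℕ, n ≤ d → ∀ x : Fin d → ℝ, ∑ i ∈ s, c i *
      (if (C i ∩ Metric.closedBall 0 R ∩ {p | ∀ j : Fin d, n ≤ j → p j = x j}).Nonempty
        then 1 else 0) = 0 := by
    intro n
    induction n with
    | zero =>
      intro _ x
      have he : ∀ i, (C i ∩ Metric.closedBall 0 R ∩
          {p | ∀ j : Fin d, 0 ≤ (j : ℕ) → p j = x j}).Nonempty ↔
          WithLp.toLp 2 x ∈ C i ∧ WithLp.toLp 2 x ∈ Metric.closedBall 0 R := by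
        intro i
        constructor
        · rintro ⟨p, hp, hpx⟩
          have : p = WithLp.toLp 2 x := by
            ext j
            exact hpx j (Nat.zero_le _)
          rw [← this]
          exact hp
        · exact fun hp => ⟨_, hp, fun j _ => rfl⟩
      simp only [he]
      by_cases hx : WithLp.toLp 2 x ∈ Metric.closedBall (0 : EuclideanSpace ℝ (Fin d)) R
      · simpa only [hx, and_true] using h (WithLp.toLp 2 x)
      · simp [hx]
    | succ n ih =>
      intro hn x
      refine sum_nonempty_of_slices s c _ (fun i => ?_) (fun i => ?_)
        (EuclideanSpace.proj (⟨n, hn⟩ : Fin d)) fun t => ?_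
      · refine ((isCompact_closedBall 0 R).inter_left (hC i)).inter_right ?_
        simp only [Set.ofPred_forall]
        exact isClosed_iInter fun j => isClosed_iInter fun _ =>
          isClosed_eq (EuclideanSpace.proj j).continuous continuous_const
      · refine ((hC' i).inter (convex_closedBall 0 R)).inter ?_
        simp only [Set.ofPred_forall]
        exact convex_iInter₂ fun j _ =>
          convex_hyperplane (EuclideanSpace.proj j : _ →L[ℝ] ℝ).toLinearMap.isLinear _
      · refine (Finset.sum_congr rfl fun i _ => ?_).trans
          (ih (by omega) (Function.update x ⟨n, hn⟩ t))
        rw [Set.inter_assoc _ _ {p | _ = t}]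
        congr 4
        ext p
        simp only [Set.mem_inter_iff, Set.mem_ofPred_eq, PiLp.proj_apply]
        constructor
        · rintro ⟨h1, h2⟩ j hj
          by_cases hjn : j = ⟨n, hn⟩
          · subst hjn
            simpa using h2
          · rw [Function.update_of_ne hjn]
            refine h1 j ?_
            have : (j : ℕ) ≠ n := fun h => hjn (Fin.ext h)
            omega
        · intro hp
          refine ⟨fun j hj => ?_, by simpa using hp ⟨n, hn⟩ le_rfl⟩
          have hjn : j ≠ ⟨n, hn⟩ := by
            rintro rfl
            simp at hj
          have := hp j (by omega)
          rwa [Function.update_of_ne hjn] at this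
  refine (Finset.sum_congr rfl fun i hi => ?_).trans (main d le_rfl 0)
  have : (C i).Nonempty ↔ (C i ∩ Metric.closedBall 0 R ∩
      {p | ∀ j : Fin d, d ≤ j → p j = (0 : Fin d → ℝ) j}).Nonempty := by
    have hu : {p : EuclideanSpace ℝ (Fin d) | ∀ j : Fin d, d ≤ j → p j = (0 : Fin d → ℝ) j}
        = Set.univ := by
      ext p
      simp only [Set.mem_ofPred_eq, Set.mem_univ, iff_true]
      exact fun j hj => absurd j.2 (by omega)
    rw [hu, Set.inter_univ]
    exact ⟨hR i hi, fun h => h.mono Set.inter_subset_left⟩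
  simp only [this]

open Classical in
theorem indicatorSum_apply {d : ℕ} (f : AddMonoidAlgebra ℂ (polyhedra d))
    (x : EuclideanSpace ℝ (Fin d)) :
    indicatorSum d f x = ∑ P ∈ f.coeff.support,
      f.coeff P * (if x ∈ (P : Set (EuclideanSpace ℝ (Fin d))) then 1 else 0) := by
  have h : indicatorSum d f = Finsupp.linearCombination ℂ (fun P : polyhedra d =>
    (P : Set (EuclideanSpace ℝ (Fin d))).indicator (fun _ => (1 : ℂ))) f.coeff := rfl
  rw [h, Finsupp.linearCombination_apply, Finsupp.sum, Finset.sum_apply]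
  simp [Set.indicator_apply]

theorem indicatorSum_single {d : ℕ} (P : polyhedra d) (c : ℂ) :
    indicatorSum d (AddMonoidAlgebra.single P c) =
      c • (P : Set (EuclideanSpace ℝ (Fin d))).indicator (fun _ => (1 : ℂ)) := by
  have h : indicatorSum d (AddMonoidAlgebra.single P c) =
    Finsupp.linearCombination ℂ (fun P : polyhedra d =>
    (P : Set (EuclideanSpace ℝ (Fin d))).indicator (fun _ => (1 : ℂ))) (Finsupp.single P c) := rfl
  rw [h, Finsupp.linearCombination_single]

/-- Minkowski multiplication is well defined on functions. -/
theorem indicatorSum_mul_eq_zero {d : ℕ} (g f : AddMonoidAlgebra ℂ (polyhedra d))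
    (hf : indicatorSum d f = 0) : indicatorSum d (g * f) = 0 := by
  classical
  induction g using AddMonoidAlgebra.induction_linear with
  | zero => simp
  | add g₁ g₂ h₁ h₂ => rw [add_mul, map_add, h₁, h₂, add_zero]
  | single Q a =>
    have hexp : AddMonoidAlgebra.single Q a * f =
        ∑ P ∈ f.coeff.support, AddMonoidAlgebra.single (Q + P) (a * f.coeff P) := by
      conv_lhs => rw [← AddMonoidAlgebra.sum_coeff_single f]
      simp [Finsupp.sum, Finset.mul_sum, AddMonoidAlgebra.single_mul_single]
    ext x
    rw [hexp, map_sum, Finset.sum_apply]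
    simp only [indicatorSum_single, Pi.smul_apply, smul_eq_mul, Set.indicator_apply, mul_assoc,
      ← Finset.mul_sum, Pi.zero_apply]
    refine mul_eq_zero_of_right a ?_
    have hE := sum_nonempty_eq_zero f.coeff.support (fun P => f.coeff P)
      (fun P => (P : Set (EuclideanSpace ℝ (Fin d))) ∩
        {y | x - y ∈ (Q : Set (EuclideanSpace ℝ (Fin d)))})
      (fun P => (IsPolyhedron.isClosed P.2).inter
        ((IsPolyhedron.isClosed Q.2).preimage (continuous_const.sub continuous_id)))
      (fun P => (IsPolyhedron.convex P.2).inter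
        (by
          intro y hy z hz a b ha hb hab
          have h1 := IsPolyhedron.convex Q.2 hy hz ha hb hab
          have h2 : x - (a • y + b • z) = a • (x - y) + b • (x - z) := by
            rw [smul_sub, smul_sub, sub_add_sub_comm, ← add_smul, hab, one_smul]
          rw [Set.mem_ofPred_eq, h2]
          exact h1)) (by
        intro y
        by_cases hy : x - y ∈ (Q : Set (EuclideanSpace ℝ (Fin d)))
        · have := congrFun hf y
          rw [indicatorSum_apply] at this
          simpa [hy] using this
        · simp [hy])
    refine (Finset.sum_congr rfl fun P _ => ?_).trans hE
    have : x ∈ ((Q + P : polyhedra d) : Set (EuclideanSpace ℝ (Fin d))) ↔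
        ((P : Set (EuclideanSpace ℝ (Fin d))) ∩
          {y | x - y ∈ (Q : Set (EuclideanSpace ℝ (Fin d)))}).Nonempty := by
      rw [AddSubmonoid.coe_add, Set.mem_add]
      constructor
      · rintro ⟨q, hq, p, hp, rfl⟩
        exact ⟨p, hp, by simpa using hq⟩
      · rintro ⟨p, hp, hq⟩
        exact ⟨_, hq, p, hp, by simp⟩
    simp only [this]

/-- The formal linear combinations of polyhedra whose indicator sum is the zero function. -/
def indicatorRelations (d : ℕ) : Ideal (AddMonoidAlgebra ℂ (polyhedra d)) where
  carrier := {f | indicatorSum d f = 0}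
  add_mem' hf hg := by
    simp only [Set.mem_ofPred_eq] at hf hg ⊢
    rw [map_add, hf, hg, add_zero]
  zero_mem' := map_zero _
  smul_mem' g f hf := indicatorSum_mul_eq_zero g f hf

/-- The Minkowski ring of all closed convex polyhedra of `ℝᵈ`, as a `ℂ`-algebra: the space of
functions spanned by indicator functions of polyhedra (formal combinations modulo those that
vanish as functions, see `MinkowskiRing.equivSpan`), with `[P] * [Q] = [P + Q]`. -/
abbrev MinkowskiRing (d : ℕ) : Type := AddMonoidAlgebra ℂ (polyhedra d) ⧸ indicatorRelations d

namespace MinkowskiRing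

/-- The element `[P]` of the Minkowski ring. -/
def ind {d : ℕ} (P : polyhedra d) : MinkowskiRing d :=
  Ideal.Quotient.mk (indicatorRelations d) (AddMonoidAlgebra.single P 1)

theorem ind_mul_ind {d : ℕ} (P Q : polyhedra d) : ind P * ind Q = ind (P + Q) := by
  simp [ind, ← map_mul, AddMonoidAlgebra.single_mul_single]

theorem ind_zero {d : ℕ} : ind (0 : polyhedra d) = 1 := rfl

/-- The function on `ℝᵈ` that an element of the Minkowski ring is. -/
def toFun {d : ℕ} : MinkowskiRing d →ₗ[ℂ] (EuclideanSpace ℝ (Fin d) → ℂ) :=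
  ((indicatorRelations d).restrictScalars ℂ).liftQ (indicatorSum d) fun _ hf => hf

theorem toFun_ind {d : ℕ} (P : polyhedra d) :
    toFun (ind P) = (P : Set (EuclideanSpace ℝ (Fin d))).indicator (fun _ => (1 : ℂ)) := by
  have h : toFun (ind P) = indicatorSum d (AddMonoidAlgebra.single P 1) := rfl
  rw [h, indicatorSum_single, one_smul]

theorem toFun_injective {d : ℕ} :
    Function.Injective (toFun : MinkowskiRing d → (EuclideanSpace ℝ (Fin d) → ℂ)) := by
  rw [injective_iff_map_eq_zero]
  intro m hm
  obtain ⟨f, rfl⟩ := Ideal.Quotient.mk_surjective m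
  exact Ideal.Quotient.eq_zero_iff_mem.2 hm

theorem range_toFun {d : ℕ} : LinearMap.range (toFun (d := d)) =
    Submodule.span ℂ (Set.range fun P : polyhedra d =>
      (P : Set (EuclideanSpace ℝ (Fin d))).indicator (fun _ => (1 : ℂ))) := by
  have h : LinearMap.range (toFun (d := d)) = LinearMap.range (indicatorSum d) :=
    Submodule.range_liftQ _ _ _
  rw [h, indicatorSum, LinearEquiv.range_comp, Finsupp.range_linearCombination]

/-- The Minkowski ring is the space of functions spanned by the indicator functions of closed
convex polyhedra. -/
def equivSpan (d : ℕ) : MinkowskiRing d ≃ₗ[ℂ]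
    Submodule.span ℂ (Set.range fun P : polyhedra d =>
      (P : Set (EuclideanSpace ℝ (Fin d))).indicator (fun _ => (1 : ℂ))) :=
  (LinearEquiv.ofInjective toFun toFun_injective).trans (LinearEquiv.ofEq _ _ range_toFun)

end MinkowskiRing

/-- `M^±(D)`: the subalgebra of the Minkowski ring generated by the indicator functions of the
members of `D` and their multiplicative inverses. -/
def laurentMinkowskiRing {d : ℕ} (D : Set (polyhedra d)) : Subalgebra ℂ (MinkowskiRing d) :=
  Algebra.adjoin ℂ (MinkowskiRing.ind '' D ∪ {m | ∃ P ∈ D, MinkowskiRing.ind P * m = 1})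

/-! ## Polygons on the triangular grid -/

/-- The closed half-planes bounded by the lines of the regular triangular grid of side `1`, that
is, by the lines `y = ℓ √3 / 2`, `y = √3 x + ℓ √3` and `y = -√3 x + ℓ √3` with `ℓ ∈ ℤ`. -/
inductive IsGridHalfPlane : Set (EuclideanSpace ℝ (Fin 2)) → Prop
  | below_horizontal (l : ℤ) : IsGridHalfPlane {p | p 1 ≤ l * (√3 / 2)}
  | above_horizontal (l : ℤ) : IsGridHalfPlane {p | p 1 ≥ l * (√3 / 2)}
  | below_rising (l : ℤ) : IsGridHalfPlane {p | p 1 ≤ √3 * p 0 + l * √3}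
  | above_rising (l : ℤ) : IsGridHalfPlane {p | p 1 ≥ √3 * p 0 + l * √3}
  | below_falling (l : ℤ) : IsGridHalfPlane {p | p 1 ≤ -√3 * p 0 + l * √3}
  | above_falling (l : ℤ) : IsGridHalfPlane {p | p 1 ≥ -√3 * p 0 + l * √3}

/-- The closed convex polygons on the triangular grid (points and segments included): the
nonempty bounded intersections of finitely many grid half-planes. -/
def gridPolygons : Set (polyhedra 2) :=
  {P | (P : Set (EuclideanSpace ℝ (Fin 2))).Nonempty ∧
    Bornology.IsBounded (P : Set (EuclideanSpace ℝ (Fin 2))) ∧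
    ∃ H : Set (Set (EuclideanSpace ℝ (Fin 2))), H.Finite ∧ (∀ h ∈ H, IsGridHalfPlane h) ∧
      (P : Set (EuclideanSpace ℝ (Fin 2))) = ⋂₀ H}

/-- The vertices `O`, `A`, `B` of the unit triangle. -/
def vertexO : EuclideanSpace ℝ (Fin 2) := !₂[0, 0]

/-- See `vertexO`. -/
def vertexA : EuclideanSpace ℝ (Fin 2) := !₂[1, 0]

/-- See `vertexO`. -/
def vertexB : EuclideanSpace ℝ (Fin 2) := !₂[1 / 2, √3 / 2]

/-- Names of the six variables. -/
inductive GridVar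
  | x₁ | x₂ | y₁ | y₂ | y₃ | z

open Classical in
/-- The face of the triangle `OAB` attached to each variable. -/
def gridFace : GridVar → polyhedra 2
  | .x₁ => polytope {vertexA}
  | .x₂ => polytope {vertexB}
  | .y₁ => polytope {vertexO, vertexA}
  | .y₂ => polytope {vertexO, vertexB}
  | .y₃ => polytope {vertexA, vertexB}
  | .z => polytope {vertexO, vertexA, vertexB}

/-! ## Laurent polynomials -/

/-- The Laurent polynomial ring over `ℂ` in the variables `σ`. -/
abbrev MvLaurentPolynomial (σ : Type) : Type := AddMonoidAlgebra ℂ (σ →₀ ℤ)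

/-- The variable `i` as a Laurent polynomial. -/
def MvLaurentPolynomial.X {σ : Type} (i : σ) : MvLaurentPolynomial σ :=
  AddMonoidAlgebra.single (Finsupp.single i 1) 1

open MvLaurentPolynomial GridVar in
/-- The three interval relations. -/
def relationsG₁ : Set (MvLaurentPolynomial GridVar) :=
  {(X y₁ - 1) * (X y₁ - X x₁), (X y₂ - 1) * (X y₂ - X x₂), (X y₃ - X x₁) * (X y₃ - X x₂)}

open MvLaurentPolynomial GridVar in
/-- The six triangle-covering relations. -/
def relationsG₂ : Set (MvLaurentPolynomial GridVar) :=
  {(X z - 1) * (X z - X y₃), (X z - X x₁) * (X z - X y₂), (X z - X x₂) * (X z - X y₁),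
    (X z - X y₁) * (X z - X y₂), (X z - X y₁) * (X z - X y₃), (X z - X y₂) * (X z - X y₃)}

end

/-! In the coordinates `s`, `t` with respect to the basis `A`, `B`, the grid lines are the integer
level lines of `s`, `t` and `s + t`. A grid polygon is therefore a hexagon given by six integer
bounds, possibly with some sides of length zero, and for tight bounds Minkowski addition is addition
of bounds (`hexagonSet_add`). Side lengths show that every such polygon is, up to cancelling
translations and triangles, a Minkowski sum of faces of `OAB` (`exists_faceBounds_sum`). This gives
generation by the six faces.

Each generator of `I` vanishes in the Minkowski ring for one geometric reason: `2W` is covered by `W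
+ P` and `W + Q`, which meet in `P + Q`, so that `[W]² + [P][Q] = [W][P] + [W][Q]`
(`ind_sub_mul_ind_sub`).

That no further relations are needed is a matter of counting cells. Modulo `I`, every Laurent
polynomial is a linear combination of products of a monomial in `x₁^{±1}`, `x₂^{±1}` with one of `1,
y₁, y₂, y₃, z, z²` (`TriangleRelations.cellSpan_eq_top`). These six types match the translation
classes of cells of the triangular tiling: vertices, edges in three directions, upward and downward
triangles. Evaluation at one point inside each cell is triangular, so the images of these products
are linearly independent functions (`linearIndependent_family`). A spanning family with linearly
independent image makes the presentation map injective. -/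

noncomputable section

/-! ## Lattice coordinates -/

/-- The first coordinate with respect to the basis `A`, `B`. -/
def latticeFst : Module.Dual ℝ (EuclideanSpace ℝ (Fin 2)) :=
  (EuclideanSpace.proj 0 : _ →L[ℝ] ℝ).toLinearMap -
    (√3)⁻¹ • (EuclideanSpace.proj 1 : _ →L[ℝ] ℝ).toLinearMap

/-- The second coordinate with respect to the basis `A`, `B`. -/
def latticeSnd : Module.Dual ℝ (EuclideanSpace ℝ (Fin 2)) :=
  (2 * (√3)⁻¹) • (EuclideanSpace.proj 1 : _ →L[ℝ] ℝ).toLinearMap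

theorem latticeFst_apply (p : EuclideanSpace ℝ (Fin 2)) :
    latticeFst p = p 0 - (√3)⁻¹ * p 1 := by
  simp [latticeFst]

theorem latticeSnd_apply (p : EuclideanSpace ℝ (Fin 2)) :
    latticeSnd p = 2 * (√3)⁻¹ * p 1 := by
  simp [latticeSnd]

theorem lattice_eq (p : EuclideanSpace ℝ (Fin 2)) :
    latticeFst p • vertexA + latticeSnd p • vertexB = p := by
  have h : √3 ≠ 0 := by positivity
  ext i
  fin_cases i
  · simp [latticeFst_apply, latticeSnd_apply, vertexA, vertexB]
    ring
  · simp [latticeSnd_apply, vertexA, vertexB]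
    field_simp

theorem latticeFst_vertexA : latticeFst vertexA = 1 := by
  simp [latticeFst_apply, vertexA]

theorem latticeSnd_vertexA : latticeSnd vertexA = 0 := by
  simp [latticeSnd_apply, vertexA]

theorem latticeFst_vertexB : latticeFst vertexB = 0 := by
  have h : √3 ≠ 0 := by positivity
  simp [latticeFst_apply, vertexB]
  field_simp
  norm_num

theorem latticeSnd_vertexB : latticeSnd vertexB = 1 := by
  have h : √3 ≠ 0 := by positivity
  simp [latticeSnd_apply, vertexB]
  field_simp

theorem vertexO_eq_zero : vertexO = 0 := by
  ext i
  fin_cases i <;> simp [vertexO]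

/-- The point with given lattice coordinates. -/
def latticePoint (s t : ℝ) : EuclideanSpace ℝ (Fin 2) := s • vertexA + t • vertexB

@[simp] theorem latticeFst_latticePoint (s t : ℝ) : latticeFst (latticePoint s t) = s := by
  simp [latticePoint, latticeFst_vertexA, latticeFst_vertexB]

@[simp] theorem latticeSnd_latticePoint (s t : ℝ) : latticeSnd (latticePoint s t) = t := by
  simp [latticePoint, latticeSnd_vertexA, latticeSnd_vertexB]

theorem ext_lattice {p q : EuclideanSpace ℝ (Fin 2)} (h₁ : latticeFst p = latticeFst q)
    (h₂ : latticeSnd p = latticeSnd q) : p = q := by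
  rw [← lattice_eq p, ← lattice_eq q, h₁, h₂]

/-! ## Hexagons -/

/-- The set of points whose lattice coordinates `s`, `t` satisfy `p 0 ≤ s ≤ p 1`,
`p 2 ≤ t ≤ p 3` and `p 4 ≤ s + t ≤ p 5`. -/
def hexagonSet (p : Fin 6 → ℤ) : Set (EuclideanSpace ℝ (Fin 2)) :=
  {x | (p 0 ≤ latticeFst x ∧ latticeFst x ≤ p 1) ∧ (p 2 ≤ latticeSnd x ∧ latticeSnd x ≤ p 3) ∧
    (p 4 ≤ latticeFst x + latticeSnd x ∧ latticeFst x + latticeSnd x ≤ p 5)}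

theorem mem_hexagonSet {p : Fin 6 → ℤ} {x : EuclideanSpace ℝ (Fin 2)} :
    x ∈ hexagonSet p ↔ (p 0 ≤ latticeFst x ∧ latticeFst x ≤ p 1) ∧
      (p 2 ≤ latticeSnd x ∧ latticeSnd x ≤ p 3) ∧
      (p 4 ≤ latticeFst x + latticeSnd x ∧ latticeFst x + latticeSnd x ≤ p 5) := Iff.rfl

theorem isPolyhedron_ge {V : Type*} [AddCommGroup V] [Module ℝ V]
    (f : Module.Dual ℝ V) (b : ℝ) : IsPolyhedron {x | b ≤ f x} := by
  convert isPolyhedron_le (-f) (-b) using 1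
  ext x
  simp

/-- `hexagonSet p` as a polyhedron. -/
def hexagon (p : Fin 6 → ℤ) : polyhedra 2 :=
  ⟨hexagonSet p, ((isPolyhedron_ge _ _).inter (isPolyhedron_le _ _)).inter
    (((isPolyhedron_ge _ _).inter (isPolyhedron_le _ _)).inter
      ((isPolyhedron_ge (latticeFst + latticeSnd) _).inter
        (isPolyhedron_le (latticeFst + latticeSnd) _)))⟩

theorem coe_hexagon (p : Fin 6 → ℤ) :
    (hexagon p : Set (EuclideanSpace ℝ (Fin 2))) = hexagonSet p := rfl

/-- The bounds that are attained by the points of the hexagon: the six inequalities say that its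
sides have nonnegative length. -/
def tightBounds : AddSubmonoid (Fin 6 → ℤ) where
  carrier := {p | p 0 + p 2 ≤ p 4 ∧ p 4 ≤ p 0 + p 3 ∧ p 4 ≤ p 1 + p 2 ∧
    p 0 + p 3 ≤ p 5 ∧ p 1 + p 2 ≤ p 5 ∧ p 5 ≤ p 1 + p 3}
  zero_mem' := by simp
  add_mem' := by
    intro p q hp hq
    simp only [Set.mem_ofPred_eq, Pi.add_apply] at *
    omega

theorem mem_tightBounds {p : Fin 6 → ℤ} : p ∈ tightBounds ↔
    p 0 + p 2 ≤ p 4 ∧ p 4 ≤ p 0 + p 3 ∧ p 4 ≤ p 1 + p 2 ∧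
    p 0 + p 3 ≤ p 5 ∧ p 1 + p 2 ≤ p 5 ∧ p 5 ≤ p 1 + p 3 := Iff.rfl

/-- A system of bounds on `s`, `t`, `s + t` is solvable as soon as it is consistent. -/
theorem exists_between_bounds {a b c d e f : ℝ} (h₁ : a ≤ b) (h₂ : c ≤ d) (h₃ : e ≤ f)
    (h₄ : a + c ≤ f) (h₅ : e ≤ b + d) :
    ∃ s t : ℝ, (a ≤ s ∧ s ≤ b) ∧ (c ≤ t ∧ t ≤ d) ∧ (e ≤ s + t ∧ s + t ≤ f) := by
  -- Eliminating `t` leaves the bounds `a, e - d ≤ s ≤ b, f - c`. The least admissible `s` is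
  -- chosen, and then the least admissible `t`.
  have hs₁ := le_max_left a (e - d)
  have hs₂ := le_max_right a (e - d)
  have hs₃ : max a (e - d) ≤ b := max_le h₁ (by linarith)
  have hs₄ : max a (e - d) ≤ f - c := max_le (by linarith) (by linarith)
  generalize max a (e - d) = s at *
  have ht₁ := le_max_left c (e - s)
  have ht₂ := le_max_right c (e - s)
  have ht₃ : max c (e - s) ≤ d := max_le h₂ (by linarith)
  have ht₄ : max c (e - s) ≤ f - s := max_le (by linarith) (by linarith)
  exact ⟨s, max c (e - s), ⟨hs₁, hs₃⟩, ⟨ht₁, ht₃⟩, by linarith, by linarith⟩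

theorem hexagonSet_nonempty {p : Fin 6 → ℤ} (hp : p ∈ tightBounds) : (hexagonSet p).Nonempty := by
  rw [mem_tightBounds] at hp
  obtain ⟨s, t, h⟩ := exists_between_bounds (a := p 0) (b := p 1) (c := p 2) (d := p 3)
    (e := p 4) (f := p 5) (by norm_cast; omega) (by norm_cast; omega) (by norm_cast; omega)
    (by norm_cast; omega) (by norm_cast; omega)
  exact ⟨latticePoint s t, by simpa [mem_hexagonSet] using h⟩

/-- A point `x` is a sum exactly when the first hexagon meets `x` minus the second. That
intersection is again a system of bounds on `s`, `t`, `s + t`, and its consistency follows from the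
bounds on `x` together with tightness of `p` and `q`. Tightness is what prevents the sum of the
bounds from describing too large a set. -/
theorem hexagonSet_add {p q : Fin 6 → ℤ} (hp : p ∈ tightBounds) (hq : q ∈ tightBounds) :
    hexagonSet p + hexagonSet q = hexagonSet (p + q) := by
  ext x
  rw [Set.mem_add]
  constructor
  · rintro ⟨y, hy, w, hw, rfl⟩
    simp only [mem_hexagonSet, map_add, Pi.add_apply, Int.cast_add] at *
    obtain ⟨⟨_, _⟩, ⟨_, _⟩, _, _⟩ := hy
    obtain ⟨⟨_, _⟩, ⟨_, _⟩, _, _⟩ := hw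
    refine ⟨⟨?_, ?_⟩, ⟨?_, ?_⟩, ?_, ?_⟩ <;> linarith
  · intro hx
    simp only [mem_hexagonSet, Pi.add_apply, Int.cast_add] at hx
    obtain ⟨⟨_, _⟩, ⟨_, _⟩, _, _⟩ := hx
    rw [mem_tightBounds] at hp hq
    have hp' : (p 0 + p 2 : ℝ) ≤ p 4 ∧ (p 4 : ℝ) ≤ p 0 + p 3 ∧ (p 4 : ℝ) ≤ p 1 + p 2 ∧
        (p 0 + p 3 : ℝ) ≤ p 5 ∧ (p 1 + p 2 : ℝ) ≤ p 5 ∧ (p 5 : ℝ) ≤ p 1 + p 3 := by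
      exact_mod_cast hp
    have hq' : (q 0 + q 2 : ℝ) ≤ q 4 ∧ (q 4 : ℝ) ≤ q 0 + q 3 ∧ (q 4 : ℝ) ≤ q 1 + q 2 ∧
        (q 0 + q 3 : ℝ) ≤ q 5 ∧ (q 1 + q 2 : ℝ) ≤ q 5 ∧ (q 5 : ℝ) ≤ q 1 + q 3 := by
      exact_mod_cast hq
    obtain ⟨_, _, _, _, _, _⟩ := hp'
    obtain ⟨_, _, _, _, _, _⟩ := hq'
    -- Each maximum or minimum combines a bound of the first hexagon with one of the reflected and
    -- translated second hexagon.
    obtain ⟨s, t, ⟨h₁, h₂⟩, ⟨h₃, h₄⟩, h₅, h₆⟩ := exists_between_bounds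
      (a := max (p 0) (latticeFst x - q 1)) (b := min (p 1) (latticeFst x - q 0))
      (c := max (p 2) (latticeSnd x - q 3)) (d := min (p 3) (latticeSnd x - q 2))
      (e := max (p 4) (latticeFst x + latticeSnd x - q 5))
      (f := min (p 5) (latticeFst x + latticeSnd x - q 4))
      (by rw [max_le_iff, le_min_iff, le_min_iff]; refine ⟨⟨?_, ?_⟩, ?_, ?_⟩ <;> linarith)
      (by rw [max_le_iff, le_min_iff, le_min_iff]; refine ⟨⟨?_, ?_⟩, ?_, ?_⟩ <;> linarith)
      (by rw [max_le_iff, le_min_iff, le_min_iff]; refine ⟨⟨?_, ?_⟩, ?_, ?_⟩ <;> linarith)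
      (by
        rw [← max_add_add_right, ← max_add_add_left, ← max_add_add_left]
        simp only [max_le_iff, le_min_iff]
        refine ⟨⟨⟨?_, ?_⟩, ?_, ?_⟩, ⟨?_, ?_⟩, ?_, ?_⟩ <;> linarith)
      (by
        rw [← min_add_add_right, ← min_add_add_left, ← min_add_add_left]
        simp only [max_le_iff, le_min_iff]
        refine ⟨⟨⟨?_, ?_⟩, ?_, ?_⟩, ⟨?_, ?_⟩, ?_, ?_⟩ <;> linarith)
    rw [max_le_iff] at h₁ h₃ h₅
    rw [le_min_iff] at h₂ h₄ h₆
    refine ⟨latticePoint s t, ?_, x - latticePoint s t, ?_, by abel⟩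
    · simpa [mem_hexagonSet] using ⟨⟨h₁.1, h₂.1⟩, ⟨h₃.1, h₄.1⟩, h₅.1, h₆.1⟩
    · simp only [mem_hexagonSet, map_sub, latticeFst_latticePoint, latticeSnd_latticePoint]
      refine ⟨⟨?_, ?_⟩, ⟨?_, ?_⟩, ?_, ?_⟩ <;> linarith [h₁.2, h₂.2, h₃.2, h₄.2, h₅.2, h₆.2]

theorem hexagon_add {p q : Fin 6 → ℤ} (hp : p ∈ tightBounds) (hq : q ∈ tightBounds) :
    hexagon p + hexagon q = hexagon (p + q) :=
  Subtype.ext (hexagonSet_add hp hq)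

theorem hexagon_zero : hexagon 0 = 0 := by
  refine Subtype.ext ?_
  change hexagonSet 0 = {0}
  ext x
  simp only [mem_hexagonSet, Pi.zero_apply, Int.cast_zero, Set.mem_singleton_iff]
  constructor
  · rintro ⟨⟨h₁, h₂⟩, ⟨h₃, h₄⟩, -⟩
    exact ext_lattice (by simpa using le_antisymm h₂ h₁) (by simpa using le_antisymm h₄ h₃)
  · rintro rfl
    simp

/-- The indicator function of a hexagon, as a multiplicative function of its bounds. -/
def indHexagon : Multiplicative tightBounds →* MinkowskiRing 2 where
  toFun p := MinkowskiRing.ind (hexagon p.toAdd)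
  map_one' := by
    rw [← MinkowskiRing.ind_zero, ← hexagon_zero]
    rfl
  map_mul' p q := by
    rw [MinkowskiRing.ind_mul_ind, hexagon_add p.toAdd.2 q.toAdd.2]
    rfl

/-- If `P = Q ∪ R` and `S = Q ∩ R` then `[P] + [S] = [Q] + [R]`. -/
theorem MinkowskiRing.ind_add_ind {d : ℕ} {P Q R S : polyhedra d}
    (hP : (P : Set (EuclideanSpace ℝ (Fin d))) = ↑Q ∪ ↑R)
    (hS : (S : Set (EuclideanSpace ℝ (Fin d))) = ↑Q ∩ ↑R) : ind P + ind S = ind Q + ind R := by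
  apply toFun_injective
  rw [map_add, map_add, toFun_ind, toFun_ind, toFun_ind, toFun_ind, hP, hS,
    Set.indicator_union_add_inter]

end
noncomputable section

/-! ## The faces of the triangle -/

/-- The bounds that cut out the faces of the triangle `OAB`. -/
def faceBounds : GridVar → Fin 6 → ℤ
  | .x₁ => ![1, 1, 0, 0, 1, 1]
  | .x₂ => ![0, 0, 1, 1, 1, 1]
  | .y₁ => ![0, 1, 0, 0, 0, 1]
  | .y₂ => ![0, 0, 0, 1, 0, 1]
  | .y₃ => ![0, 1, 0, 1, 1, 1]
  | .z => ![0, 1, 0, 1, 0, 1]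

theorem faceBounds_mem (i : GridVar) : faceBounds i ∈ tightBounds := by
  rw [mem_tightBounds]
  cases i <;> simp [faceBounds]

theorem latticePoint_mem_of_convex {S : Set (EuclideanSpace ℝ (Fin 2))} (hS : Convex ℝ S)
    {x : EuclideanSpace ℝ (Fin 2)} (h₁ : 0 ≤ latticeFst x) (h₂ : 0 ≤ latticeSnd x)
    (h₃ : latticeFst x + latticeSnd x ≤ 1) (hO : vertexO ∈ S) (hA : vertexA ∈ S)
    (hB : vertexB ∈ S) : x ∈ S := by
  -- The weights are the barycentric coordinates of `x` with respect to `O`, `A`, `B`.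
  have := hS.sum_mem (t := Finset.univ)
    (w := ![1 - latticeFst x - latticeSnd x, latticeFst x, latticeSnd x])
    (z := ![vertexO, vertexA, vertexB])
    (by intro i _; fin_cases i <;> simp <;> linarith) (by simp [Fin.sum_univ_three]; ring)
    (by intro i _; fin_cases i <;> simpa)
  simpa [Fin.sum_univ_three, vertexO_eq_zero, lattice_eq] using this

theorem vertexO_mem_hexagonSet {p : Fin 6 → ℤ} : vertexO ∈ hexagonSet p ↔
    (p 0 ≤ 0 ∧ 0 ≤ p 1) ∧ (p 2 ≤ 0 ∧ 0 ≤ p 3) ∧ (p 4 ≤ 0 ∧ 0 ≤ p 5) := by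
  simp [mem_hexagonSet, vertexO_eq_zero]

theorem vertexA_mem_hexagonSet {p : Fin 6 → ℤ} : vertexA ∈ hexagonSet p ↔
    (p 0 ≤ 1 ∧ 1 ≤ p 1) ∧ (p 2 ≤ 0 ∧ 0 ≤ p 3) ∧ (p 4 ≤ 1 ∧ 1 ≤ p 5) := by
  simp only [mem_hexagonSet, latticeFst_vertexA, latticeSnd_vertexA, add_zero]
  norm_cast

theorem vertexB_mem_hexagonSet {p : Fin 6 → ℤ} : vertexB ∈ hexagonSet p ↔
    (p 0 ≤ 0 ∧ 0 ≤ p 1) ∧ (p 2 ≤ 1 ∧ 1 ≤ p 3) ∧ (p 4 ≤ 1 ∧ 1 ≤ p 5) := by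
  simp only [mem_hexagonSet, latticeFst_vertexB, latticeSnd_vertexB, zero_add]
  norm_cast

theorem convex_hexagonSet (p : Fin 6 → ℤ) : Convex ℝ (hexagonSet p) :=
  IsPolyhedron.convex (hexagon p).2

theorem gridFace_eq_hexagon (i : GridVar) : gridFace i = hexagon (faceBounds i) := by
  refine Subtype.ext (Set.Subset.antisymm ?_ ?_)
  · cases i <;> refine convexHull_min ?_ (convex_hexagonSet _) <;>
      simp [Set.insert_subset_iff, coe_hexagon, vertexO_mem_hexagonSet, vertexA_mem_hexagonSet,
        vertexB_mem_hexagonSet, faceBounds]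
  · intro x hx
    rw [coe_hexagon, mem_hexagonSet] at hx
    cases i <;> simp only [faceBounds, Matrix.cons_val, Int.cast_zero, Int.cast_one] at hx <;>
      obtain ⟨⟨h₁, h₂⟩, ⟨h₃, h₄⟩, h₅, h₆⟩ := hx <;>
      simp only [gridFace, polytope, Finset.coe_insert, Finset.coe_singleton, convexHull_singleton,
        convexHull_pair, Set.mem_singleton_iff]
    · refine ext_lattice ?_ ?_ <;> simp only [latticeFst_vertexA, latticeSnd_vertexA] <;> linarith
    · refine ext_lattice ?_ ?_ <;> simp only [latticeFst_vertexB, latticeSnd_vertexB] <;> linarith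
    · refine ⟨1 - latticeFst x, latticeFst x, by linarith, h₁, by ring, ?_⟩
      have : latticeSnd x = 0 := by linarith
      simpa [vertexO_eq_zero, this] using lattice_eq x
    · refine ⟨1 - latticeSnd x, latticeSnd x, by linarith, h₃, by ring, ?_⟩
      have : latticeFst x = 0 := by linarith
      simpa [vertexO_eq_zero, this] using lattice_eq x
    · exact ⟨latticeFst x, latticeSnd x, by linarith, h₃, by linarith, lattice_eq x⟩
    · exact latticePoint_mem_of_convex (convex_convexHull ℝ _) h₁ h₃ h₆
        (subset_convexHull ℝ _ (by simp)) (subset_convexHull ℝ _ (by simp))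
        (subset_convexHull ℝ _ (by simp))

/-- If two translates of pieces of `2 W` cover `2 W` and meet in the expected set, then the
indicator function of `W` satisfies the corresponding quadratic equation. -/
theorem ind_sub_mul_ind_sub {w p q : Fin 6 → ℤ} (hw : w ∈ tightBounds) (hp : p ∈ tightBounds)
    (hq : q ∈ tightBounds) (h₁ : hexagonSet (w + w) = hexagonSet (w + p) ∪ hexagonSet (w + q))
    (h₂ : hexagonSet (p + q) = hexagonSet (w + p) ∩ hexagonSet (w + q)) :
    (MinkowskiRing.ind (hexagon w) - MinkowskiRing.ind (hexagon p)) *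
      (MinkowskiRing.ind (hexagon w) - MinkowskiRing.ind (hexagon q)) = 0 := by
  have h := MinkowskiRing.ind_add_ind (P := hexagon (w + w)) (Q := hexagon (w + p))
    (R := hexagon (w + q)) (S := hexagon (p + q)) h₁ h₂
  rw [← hexagon_add hw hw, ← hexagon_add hw hp, ← hexagon_add hw hq, ← hexagon_add hp hq,
    ← MinkowskiRing.ind_mul_ind, ← MinkowskiRing.ind_mul_ind, ← MinkowskiRing.ind_mul_ind,
    ← MinkowskiRing.ind_mul_ind] at h
  linear_combination h

/-! ### The nine quadratic relations as coverings of doubled faces -/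

section Relations

open GridVar

/-- The indicator function of a face of the triangle. -/
def indFace (i : GridVar) : MinkowskiRing 2 := MinkowskiRing.ind (gridFace i)

theorem indFace_relation_one {i j : GridVar}
    (h₁ : hexagonSet (faceBounds i + faceBounds i) =
      hexagonSet (faceBounds i) ∪ hexagonSet (faceBounds i + faceBounds j))
    (h₂ : hexagonSet (faceBounds j) =
      hexagonSet (faceBounds i) ∩ hexagonSet (faceBounds i + faceBounds j)) :
    (indFace i - 1) * (indFace i - indFace j) = 0 := by
  have h := ind_sub_mul_ind_sub (faceBounds_mem i) (zero_mem tightBounds) (faceBounds_mem j)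
    (by rwa [add_zero]) (by rwa [zero_add, add_zero])
  rwa [hexagon_zero, MinkowskiRing.ind_zero, ← gridFace_eq_hexagon, ← gridFace_eq_hexagon] at h

theorem indFace_relation {i j k : GridVar}
    (h₁ : hexagonSet (faceBounds i + faceBounds i) =
      hexagonSet (faceBounds i + faceBounds j) ∪ hexagonSet (faceBounds i + faceBounds k))
    (h₂ : hexagonSet (faceBounds j + faceBounds k) =
      hexagonSet (faceBounds i + faceBounds j) ∩ hexagonSet (faceBounds i + faceBounds k)) :
    (indFace i - indFace j) * (indFace i - indFace k) = 0 := by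
  have h := ind_sub_mul_ind_sub (faceBounds_mem i) (faceBounds_mem j) (faceBounds_mem k) h₁ h₂
  rwa [← gridFace_eq_hexagon, ← gridFace_eq_hexagon, ← gridFace_eq_hexagon] at h

theorem indFace_y₁ : (indFace y₁ - 1) * (indFace y₁ - indFace x₁) = 0 := by
  apply indFace_relation_one <;> ext x <;>
    simp only [Set.mem_union, Set.mem_inter_iff, mem_hexagonSet, Pi.add_apply, faceBounds,
      Matrix.cons_val, Int.reduceAdd] <;> push_cast <;> grind

theorem indFace_y₂ : (indFace y₂ - 1) * (indFace y₂ - indFace x₂) = 0 := by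
  apply indFace_relation_one <;> ext x <;>
    simp only [Set.mem_union, Set.mem_inter_iff, mem_hexagonSet, Pi.add_apply, faceBounds,
      Matrix.cons_val, Int.reduceAdd] <;> push_cast <;> grind

theorem indFace_y₃ : (indFace y₃ - indFace x₁) * (indFace y₃ - indFace x₂) = 0 := by
  apply indFace_relation <;> ext x <;>
    simp only [Set.mem_union, Set.mem_inter_iff, mem_hexagonSet, Pi.add_apply, faceBounds,
      Matrix.cons_val, Int.reduceAdd] <;> push_cast <;> grind

theorem indFace_z_y₃ : (indFace z - 1) * (indFace z - indFace y₃) = 0 := by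
  apply indFace_relation_one <;> ext x <;>
    simp only [Set.mem_union, Set.mem_inter_iff, mem_hexagonSet, Pi.add_apply, faceBounds,
      Matrix.cons_val, Int.reduceAdd] <;> push_cast <;> grind

theorem indFace_z_x₁_y₂ : (indFace z - indFace x₁) * (indFace z - indFace y₂) = 0 := by
  apply indFace_relation <;> ext x <;>
    simp only [Set.mem_union, Set.mem_inter_iff, mem_hexagonSet, Pi.add_apply, faceBounds,
      Matrix.cons_val, Int.reduceAdd] <;> push_cast <;> grind

theorem indFace_z_x₂_y₁ : (indFace z - indFace x₂) * (indFace z - indFace y₁) = 0 := by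
  apply indFace_relation <;> ext x <;>
    simp only [Set.mem_union, Set.mem_inter_iff, mem_hexagonSet, Pi.add_apply, faceBounds,
      Matrix.cons_val, Int.reduceAdd] <;> push_cast <;> grind

theorem indFace_z_y₁_y₂ : (indFace z - indFace y₁) * (indFace z - indFace y₂) = 0 := by
  apply indFace_relation <;> ext x <;>
    simp only [Set.mem_union, Set.mem_inter_iff, mem_hexagonSet, Pi.add_apply, faceBounds,
      Matrix.cons_val, Int.reduceAdd] <;> push_cast <;> grind

theorem indFace_z_y₁_y₃ : (indFace z - indFace y₁) * (indFace z - indFace y₃) = 0 := by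
  apply indFace_relation <;> ext x <;>
    simp only [Set.mem_union, Set.mem_inter_iff, mem_hexagonSet, Pi.add_apply, faceBounds,
      Matrix.cons_val, Int.reduceAdd] <;> push_cast <;> grind

theorem indFace_z_y₂_y₃ : (indFace z - indFace y₂) * (indFace z - indFace y₃) = 0 := by
  apply indFace_relation <;> ext x <;>
    simp only [Set.mem_union, Set.mem_inter_iff, mem_hexagonSet, Pi.add_apply, faceBounds,
      Matrix.cons_val, Int.reduceAdd] <;> push_cast <;> grind

end Relations

/-! ### Algebraic consequences of the relations -/

theorem isUnit_ind_hexagon_of_point (a b : ℤ) :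
    IsUnit (MinkowskiRing.ind (hexagon ![a, a, b, b, a + b, a + b])) := by
  refine IsUnit.of_mul_eq_one (MinkowskiRing.ind (hexagon (-![a, a, b, b, a + b, a + b]))) ?_
  rw [MinkowskiRing.ind_mul_ind, hexagon_add, add_neg_cancel, hexagon_zero, MinkowskiRing.ind_zero]
  all_goals simp [mem_tightBounds, add_comm]

/-- The data that the relations between the faces of a triangle are about. -/
structure TriangleRelations {R : Type*} [CommRing R] (v : GridVar → R) : Prop where
  isUnit_x₁ : IsUnit (v .x₁)
  isUnit_x₂ : IsUnit (v .x₂)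
  y₁ : (v .y₁ - 1) * (v .y₁ - v .x₁) = 0
  y₂ : (v .y₂ - 1) * (v .y₂ - v .x₂) = 0
  y₃ : (v .y₃ - v .x₁) * (v .y₃ - v .x₂) = 0
  z_y₃ : (v .z - 1) * (v .z - v .y₃) = 0
  z_x₁_y₂ : (v .z - v .x₁) * (v .z - v .y₂) = 0
  z_x₂_y₁ : (v .z - v .x₂) * (v .z - v .y₁) = 0
  z_y₁_y₂ : (v .z - v .y₁) * (v .z - v .y₂) = 0
  z_y₁_y₃ : (v .z - v .y₁) * (v .z - v .y₃) = 0
  z_y₂_y₃ : (v .z - v .y₂) * (v .z - v .y₃) = 0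

theorem triangleRelations_indFace : TriangleRelations indFace where
  isUnit_x₁ := by
    rw [indFace, gridFace_eq_hexagon]
    exact isUnit_ind_hexagon_of_point 1 0
  isUnit_x₂ := by
    rw [indFace, gridFace_eq_hexagon]
    exact isUnit_ind_hexagon_of_point 0 1
  y₁ := indFace_y₁
  y₂ := indFace_y₂
  y₃ := indFace_y₃
  z_y₃ := indFace_z_y₃
  z_x₁_y₂ := indFace_z_x₁_y₂
  z_x₂_y₁ := indFace_z_x₂_y₁
  z_y₁_y₂ := indFace_z_y₁_y₂
  z_y₁_y₃ := indFace_z_y₁_y₃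
  z_y₂_y₃ := indFace_z_y₂_y₃

namespace TriangleRelations

variable {R : Type*} [CommRing R] {v : GridVar → R}

theorem y₁_mul (h : TriangleRelations v) : v .y₁ * (1 + v .x₁ - v .y₁) = v .x₁ := by
  linear_combination -h.y₁

theorem y₂_mul (h : TriangleRelations v) : v .y₂ * (1 + v .x₂ - v .y₂) = v .x₂ := by
  linear_combination -h.y₂

theorem y₃_mul (h : TriangleRelations v) :
    v .y₃ * (v .x₁ + v .x₂ - v .y₃) = v .x₁ * v .x₂ := by
  linear_combination -h.y₃

/-- Multiplication by `z - 1` identifies `z` with `y₃`, and `y₃` is a root of `(w - x₁)(w - x₂)`. -/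
theorem z_cubic (h : TriangleRelations v) : (v .z - 1) * (v .z - v .x₁) * (v .z - v .x₂) = 0 := by
  linear_combination (v .z + v .y₃ - v .x₁ - v .x₂) * h.z_y₃ + (v .z - 1) * h.y₃

theorem z_mul (h : TriangleRelations v) :
    v .z * (v .z ^ 2 - (1 + v .x₁ + v .x₂) * v .z + (v .x₁ + v .x₂ + v .x₁ * v .x₂)) =
      v .x₁ * v .x₂ := by
  linear_combination h.z_cubic

/-- Each of `y₁`, `y₂`, `y₃`, `z` is a root of a monic polynomial whose constant term is, up to
sign, a product of the units `x₁`, `x₂`, so it divides a unit. -/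
theorem isUnit (h : TriangleRelations v) (i : GridVar) : IsUnit (v i) := by
  have h₁₂ := h.isUnit_x₁.mul h.isUnit_x₂
  cases i
  · exact h.isUnit_x₁
  · exact h.isUnit_x₂
  · exact isUnit_of_mul_isUnit_left (h.y₁_mul ▸ h.isUnit_x₁)
  · exact isUnit_of_mul_isUnit_left (h.y₂_mul ▸ h.isUnit_x₂)
  · exact isUnit_of_mul_isUnit_left (h.y₃_mul ▸ h₁₂)
  · exact isUnit_of_mul_isUnit_left (h.z_mul ▸ h₁₂)

end TriangleRelations

end
noncomputable section

/-! ## Polygons on the grid are hexagons -/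

theorem le_horizontal_iff (x : EuclideanSpace ℝ (Fin 2)) (l : ℤ) :
    x 1 ≤ l * (√3 / 2) ↔ latticeSnd x ≤ l := by
  have h : 0 < √3 := by positivity
  rw [latticeSnd_apply, show 2 * (√3)⁻¹ * x 1 = x 1 / (√3 / 2) by field_simp,
    div_le_iff₀ (by positivity)]

theorem horizontal_le_iff (x : EuclideanSpace ℝ (Fin 2)) (l : ℤ) :
    l * (√3 / 2) ≤ x 1 ↔ l ≤ latticeSnd x := by
  have h : 0 < √3 := by positivity
  rw [latticeSnd_apply, show 2 * (√3)⁻¹ * x 1 = x 1 / (√3 / 2) by field_simp,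
    le_div_iff₀ (by positivity)]

theorem le_rising_iff (x : EuclideanSpace ℝ (Fin 2)) (l : ℤ) :
    x 1 ≤ √3 * x 0 + l * √3 ↔ -l ≤ latticeFst x := by
  have h : 0 < √3 := by positivity
  rw [latticeFst_apply, show x 0 - (√3)⁻¹ * x 1 = (√3 * x 0 - x 1) / √3 by field_simp,
    le_div_iff₀ h]
  constructor <;> intro _ <;> linarith

theorem rising_le_iff (x : EuclideanSpace ℝ (Fin 2)) (l : ℤ) :
    √3 * x 0 + l * √3 ≤ x 1 ↔ latticeFst x ≤ -l := by
  have h : 0 < √3 := by positivity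
  rw [latticeFst_apply, show x 0 - (√3)⁻¹ * x 1 = (√3 * x 0 - x 1) / √3 by field_simp,
    div_le_iff₀ h]
  constructor <;> intro _ <;> linarith

theorem le_falling_iff (x : EuclideanSpace ℝ (Fin 2)) (l : ℤ) :
    x 1 ≤ -√3 * x 0 + l * √3 ↔ latticeFst x + latticeSnd x ≤ l := by
  have h : 0 < √3 := by positivity
  rw [latticeFst_apply, latticeSnd_apply,
    show x 0 - (√3)⁻¹ * x 1 + 2 * (√3)⁻¹ * x 1 = (√3 * x 0 + x 1) / √3 by field_simp; ring,
    div_le_iff₀ h]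
  constructor <;> intro _ <;> linarith

theorem falling_le_iff (x : EuclideanSpace ℝ (Fin 2)) (l : ℤ) :
    -√3 * x 0 + l * √3 ≤ x 1 ↔ l ≤ latticeFst x + latticeSnd x := by
  have h : 0 < √3 := by positivity
  rw [latticeFst_apply, latticeSnd_apply,
    show x 0 - (√3)⁻¹ * x 1 + 2 * (√3)⁻¹ * x 1 = (√3 * x 0 + x 1) / √3 by field_simp; ring,
    le_div_iff₀ h]
  constructor <;> intro _ <;> linarith

theorem IsGridHalfPlane.inter_hexagonSet {h : Set (EuclideanSpace ℝ (Fin 2))}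
    (hh : IsGridHalfPlane h) (p : Fin 6 → ℤ) : ∃ q, h ∩ hexagonSet p = hexagonSet q := by
  cases hh with
  | below_horizontal l =>
    refine ⟨![p 0, p 1, p 2, min (p 3) l, p 4, p 5], ?_⟩
    ext x
    simp only [Set.mem_inter_iff, Set.mem_ofPred_eq, mem_hexagonSet, le_horizontal_iff,
      Matrix.cons_val, Int.cast_min, le_min_iff]
    tauto
  | above_horizontal l =>
    refine ⟨![p 0, p 1, max (p 2) l, p 3, p 4, p 5], ?_⟩
    ext x
    simp only [Set.mem_inter_iff, Set.mem_ofPred_eq, mem_hexagonSet, ge_iff_le, horizontal_le_iff,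
      Matrix.cons_val, Int.cast_max, max_le_iff]
    tauto
  | below_rising l =>
    refine ⟨![max (p 0) (-l), p 1, p 2, p 3, p 4, p 5], ?_⟩
    ext x
    simp only [Set.mem_inter_iff, Set.mem_ofPred_eq, mem_hexagonSet, le_rising_iff,
      Matrix.cons_val, Int.cast_max, Int.cast_neg, max_le_iff]
    tauto
  | above_rising l =>
    refine ⟨![p 0, min (p 1) (-l), p 2, p 3, p 4, p 5], ?_⟩
    ext x
    simp only [Set.mem_inter_iff, Set.mem_ofPred_eq, mem_hexagonSet, ge_iff_le, rising_le_iff,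
      Matrix.cons_val, Int.cast_min, Int.cast_neg, le_min_iff]
    tauto
  | below_falling l =>
    refine ⟨![p 0, p 1, p 2, p 3, p 4, min (p 5) l], ?_⟩
    ext x
    simp only [Set.mem_inter_iff, Set.mem_ofPred_eq, mem_hexagonSet, le_falling_iff,
      Matrix.cons_val, Int.cast_min, le_min_iff]
    tauto
  | above_falling l =>
    refine ⟨![p 0, p 1, p 2, p 3, max (p 4) l, p 5], ?_⟩
    ext x
    simp only [Set.mem_inter_iff, Set.mem_ofPred_eq, mem_hexagonSet, ge_iff_le, falling_le_iff,
      Matrix.cons_val, Int.cast_max, max_le_iff]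
    tauto

/-- Starting from a hexagon ensures that all six bounds are present, so each half-plane only
sharpens one of them. -/
theorem sInter_inter_hexagonSet {H : Set (Set (EuclideanSpace ℝ (Fin 2)))} (hH : H.Finite)
    (hH' : ∀ h ∈ H, IsGridHalfPlane h) (p : Fin 6 → ℤ) : ∃ q, ⋂₀ H ∩ hexagonSet p = hexagonSet q := by
  induction H, hH using Set.Finite.induction_on with
  | empty => exact ⟨p, by simp⟩
  | @insert h H _ _ ih =>
    obtain ⟨q, hq⟩ := ih fun h' hh' => hH' h' (Set.mem_insert_of_mem _ hh')
    obtain ⟨r, hr⟩ := (hH' h (Set.mem_insert _ _)).inter_hexagonSet q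
    exact ⟨r, by rw [Set.sInter_insert, Set.inter_assoc, hq, hr]⟩

/-! ### Bounded polygons and tightening of bounds -/

theorem exists_abs_le_of_isBounded {S : Set (EuclideanSpace ℝ (Fin 2))}
    (hS : Bornology.IsBounded S) (f : Module.Dual ℝ (EuclideanSpace ℝ (Fin 2))) :
    ∃ N : ℤ, ∀ x ∈ S, (-N : ℤ) ≤ f x ∧ f x ≤ N := by
  obtain ⟨C, hC⟩ := hS.exists_norm_le
  obtain ⟨N, hN⟩ := exists_int_gt (‖f.toContinuousLinearMap‖ * C)
  refine ⟨N, fun x hx => ?_⟩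
  have h : ‖f x‖ ≤ ‖f.toContinuousLinearMap‖ * C :=
    (f.toContinuousLinearMap.le_opNorm x).trans
      (mul_le_mul_of_nonneg_left (hC x hx) (norm_nonneg _))
  rw [Real.norm_eq_abs, abs_le] at h
  push_cast
  constructor <;> linarith

theorem exists_subset_hexagonSet {S : Set (EuclideanSpace ℝ (Fin 2))}
    (hS : Bornology.IsBounded S) : ∃ p, S ⊆ hexagonSet p := by
  obtain ⟨a, ha⟩ := exists_abs_le_of_isBounded hS latticeFst
  obtain ⟨b, hb⟩ := exists_abs_le_of_isBounded hS latticeSnd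
  obtain ⟨c, hc⟩ := exists_abs_le_of_isBounded hS (latticeFst + latticeSnd)
  exact ⟨![-a, a, -b, b, -c, c], fun x hx => ⟨ha x hx, hb x hx, hc x hx⟩⟩

theorem exists_tightBounds {p : Fin 6 → ℤ} (hp : (hexagonSet p).Nonempty) :
    ∃ q ∈ tightBounds, hexagonSet p = hexagonSet q := by
  -- Each bound is sharpened by the one that two others imply, for instance `s = (s + t) - t ≥ p 4 -
  -- p 3`. The new bounds are again integers, and one round suffices because the system is
  -- consistent.
  refine ⟨![max (p 0) (p 4 - p 3), min (p 1) (p 5 - p 2), max (p 2) (p 4 - p 1),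
    min (p 3) (p 5 - p 0), max (p 4) (p 0 + p 2), min (p 5) (p 1 + p 3)], ?_, ?_⟩
  · obtain ⟨x, ⟨_, _⟩, ⟨_, _⟩, _, _⟩ := hp
    have h₁ : p 0 ≤ p 1 := by exact_mod_cast (by linarith : (p 0 : ℝ) ≤ p 1)
    have h₂ : p 2 ≤ p 3 := by exact_mod_cast (by linarith : (p 2 : ℝ) ≤ p 3)
    have h₃ : p 4 ≤ p 5 := by exact_mod_cast (by linarith : (p 4 : ℝ) ≤ p 5)
    have h₄ : p 0 + p 2 ≤ p 5 := by exact_mod_cast (by linarith : (p 0 + p 2 : ℝ) ≤ p 5)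
    have h₅ : p 4 ≤ p 1 + p 3 := by exact_mod_cast (by linarith : (p 4 : ℝ) ≤ p 1 + p 3)
    rw [mem_tightBounds]
    simp only [Matrix.cons_val]
    omega
  · ext x
    simp only [mem_hexagonSet, Matrix.cons_val, Int.cast_min, Int.cast_max, max_le_iff, le_min_iff]
    push_cast
    constructor
    · rintro ⟨⟨_, _⟩, ⟨_, _⟩, _, _⟩
      refine ⟨⟨⟨?_, ?_⟩, ?_, ?_⟩, ⟨⟨?_, ?_⟩, ?_, ?_⟩, ⟨?_, ?_⟩, ?_, ?_⟩ <;> linarith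
    · rintro ⟨⟨⟨h₁, -⟩, h₂, -⟩, ⟨⟨h₃, -⟩, h₄, -⟩, ⟨h₅, -⟩, h₆, -⟩
      exact ⟨⟨h₁, h₂⟩, ⟨h₃, h₄⟩, h₅, h₆⟩

theorem exists_eq_hexagon {P : polyhedra 2} (hP : P ∈ gridPolygons) :
    ∃ p ∈ tightBounds, P = hexagon p := by
  obtain ⟨hne, hb, H, hH, hH', hPH⟩ := hP
  obtain ⟨p, hp⟩ := exists_subset_hexagonSet hb
  obtain ⟨q, hq⟩ := sInter_inter_hexagonSet hH hH' p
  rw [← hPH, Set.inter_eq_left.2 hp] at hq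
  obtain ⟨r, hr, hqr⟩ := exists_tightBounds (hq ▸ hne)
  exact ⟨r, hr, Subtype.ext (hq.trans hqr)⟩

theorem isBounded_hexagonSet (p : Fin 6 → ℤ) : Bornology.IsBounded (hexagonSet p) := by
  have hc : Continuous fun x : ℝ × ℝ => latticePoint x.1 x.2 := by
    unfold latticePoint
    fun_prop
  refine (((isCompact_Icc (a := (p 0 : ℝ)) (b := p 1)).prod
    (isCompact_Icc (a := (p 2 : ℝ)) (b := p 3))).image hc).isBounded.subset fun x hx => ?_
  exact ⟨(latticeFst x, latticeSnd x), ⟨hx.1, hx.2.1⟩, lattice_eq x⟩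

theorem hexagon_mem_gridPolygons {p : Fin 6 → ℤ} (hp : p ∈ tightBounds) :
    hexagon p ∈ gridPolygons := by
  refine ⟨hexagonSet_nonempty hp, isBounded_hexagonSet p,
    -- The rising line with parameter `l` is `s = -l`, hence the signs.
    {{x | x 1 ≤ √3 * x 0 + (-p 0 : ℤ) * √3}, {x | x 1 ≥ √3 * x 0 + (-p 1 : ℤ) * √3},
      {x | x 1 ≥ p 2 * (√3 / 2)}, {x | x 1 ≤ p 3 * (√3 / 2)},
      {x | x 1 ≥ -√3 * x 0 + p 4 * √3}, {x | x 1 ≤ -√3 * x 0 + p 5 * √3}}, by simp, ?_, ?_⟩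
  · simp only [Set.forall_mem_insert, Set.mem_singleton_iff, forall_eq]
    exact ⟨.below_rising _, .above_rising _, .above_horizontal _, .below_horizontal _,
      .above_falling _, .below_falling _⟩
  · ext x
    simp only [Set.sInter_insert, Set.sInter_singleton, Set.mem_inter_iff, Set.mem_ofPred_eq,
      coe_hexagon, ge_iff_le, le_rising_iff, rising_le_iff, le_horizontal_iff, horizontal_le_iff,
      le_falling_iff, falling_le_iff, mem_hexagonSet]
    simp only [Int.cast_neg, neg_neg]
    tauto

theorem gridFace_mem_gridPolygons (i : GridVar) : gridFace i ∈ gridPolygons := by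
  rw [gridFace_eq_hexagon]
  exact hexagon_mem_gridPolygons (faceBounds_mem i)

/-! ## Grid polygons are Minkowski sums of faces of the triangle -/

open GridVar in
/-- Up to adding translations and triangles, a hexagon is a Minkowski sum of faces of the
triangle. -/
theorem exists_faceBounds_sum {p : Fin 6 → ℤ} (hp : p ∈ tightBounds) :
    ∃ a b c : GridVar → ℕ,
      p + (a x₁ • faceBounds x₁ + a x₂ • faceBounds x₂ + a z • faceBounds z) =
        b x₁ • faceBounds x₁ + b x₂ • faceBounds x₂ + c y₁ • faceBounds y₁ +
          c y₂ • faceBounds y₂ + c y₃ • faceBounds y₃ + c z • faceBounds z := by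
  rw [mem_tightBounds] at hp
  -- The exponents of `x₁`, `x₂` are `p 0`, `p 2`. Those of the `y`'s are the lengths of the sides
  -- `t = p 3`, `s = p 1` and `s + t = p 4`, which are not parallel to one another and whose
  -- directions are not outward normals of sides of `OAB`. The exponent of `z` is the common
  -- difference between the length of the opposite side and each of these. Exponents of either sign
  -- are split into positive and negative parts, the latter going to the left.
  refine ⟨fun | x₁ => (-p 0).toNat | x₂ => (-p 2).toNat
              | _ => (p 4 + p 5 - p 0 - p 1 - p 2 - p 3).toNat,
    fun | x₁ => (p 0).toNat | _ => (p 2).toNat,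
    fun | y₁ => (p 5 - p 3 - p 0).toNat
        | y₂ => (p 5 - p 1 - p 2).toNat
        | y₃ => (p 4 - p 0 - p 2).toNat
        | _ => (p 0 + p 1 + p 2 + p 3 - p 4 - p 5).toNat, ?_⟩
  ext i
  fin_cases i <;> simp [faceBounds] <;> omega

theorem indHexagon_faceBounds (i : GridVar) :
    indHexagon (Multiplicative.ofAdd ⟨faceBounds i, faceBounds_mem i⟩) = indFace i := by
  rw [indFace, gridFace_eq_hexagon]
  rfl

/-- Cancellation in `G` replaces negative exponents, which have no meaning as Minkowski sums of
polygons. -/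
theorem ind_mem_units_of_faces {G : Submonoid (MinkowskiRing 2)} (hG : ∀ i, indFace i ∈ G)
    (hG' : ∀ u v, v ∈ G → u * v ∈ G → u ∈ G) {P : polyhedra 2} (hP : P ∈ gridPolygons) :
    MinkowskiRing.ind P ∈ G := by
  obtain ⟨p, hp, rfl⟩ := exists_eq_hexagon hP
  obtain ⟨a, b, c, h⟩ := exists_faceBounds_sum hp
  let F : GridVar → tightBounds := fun i => ⟨faceBounds i, faceBounds_mem i⟩
  have h' : (⟨p, hp⟩ : tightBounds) + (a .x₁ • F .x₁ + a .x₂ • F .x₂ + a .z • F .z) =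
      b .x₁ • F .x₁ + b .x₂ • F .x₂ + c .y₁ • F .y₁ + c .y₂ • F .y₂ + c .y₃ • F .y₃ +
        c .z • F .z := Subtype.ext h
  have h'' := congrArg (fun q => indHexagon (Multiplicative.ofAdd q)) h'
  simp only [ofAdd_add, ofAdd_nsmul, map_mul, map_pow, F, indHexagon_faceBounds] at h''
  refine hG' _ _ ?_ (Set.mem_of_eq_of_mem h'' ?_)
  · exact mul_mem (mul_mem (pow_mem (hG _) _) (pow_mem (hG _) _)) (pow_mem (hG _) _)
  · exact mul_mem (mul_mem (mul_mem (mul_mem (mul_mem (pow_mem (hG _) _) (pow_mem (hG _) _))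
      (pow_mem (hG _) _)) (pow_mem (hG _) _)) (pow_mem (hG _) _)) (pow_mem (hG _) _)

end
noncomputable section

/-! ## Laurent polynomials -/

namespace MvLaurentPolynomial

variable {σ : Type}

theorem single_mul_X (i : σ) :
    AddMonoidAlgebra.single (Finsupp.single i (-1)) 1 * (X i : MvLaurentPolynomial σ) = 1 := by
  rw [X, AddMonoidAlgebra.single_mul_single, ← Finsupp.single_add]
  simp [AddMonoidAlgebra.one_def]

theorem isUnit_X (i : σ) : IsUnit (X i : MvLaurentPolynomial σ) :=
  IsUnit.of_mul_eq_one_right _ (single_mul_X i)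

/-- A subalgebra that contains the variables and their inverses is everything. -/
theorem subalgebra_eq_top {S : Subalgebra ℂ (MvLaurentPolynomial σ)} (h₁ : ∀ i, X i ∈ S)
    (h₂ : ∀ i, AddMonoidAlgebra.single (Finsupp.single i (-1)) 1 ∈ S) : S = ⊤ := by
  have hs : ∀ i (b : ℤ), AddMonoidAlgebra.single (Finsupp.single i b) (1 : ℂ) ∈ S := by
    intro i b
    have hpow : ∀ (c : ℤ), AddMonoidAlgebra.single (Finsupp.single i c) (1 : ℂ) ∈ S → ∀ n : ℕ,
        AddMonoidAlgebra.single (Finsupp.single i (n * c)) (1 : ℂ) ∈ S := by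
      intro c hc n
      have := pow_mem hc n
      rwa [AddMonoidAlgebra.single_pow, one_pow, Finsupp.smul_single, nsmul_eq_mul] at this
    obtain ⟨n, rfl | rfl⟩ := b.eq_nat_or_neg
    · simpa using hpow 1 (h₁ i) n
    · simpa using hpow (-1) (h₂ i) n
  have hm : ∀ m : σ →₀ ℤ, AddMonoidAlgebra.single m (1 : ℂ) ∈ S := by
    intro m
    induction m using Finsupp.induction_linear with
    | zero => exact one_mem S
    | add f g hf hg =>
      have := mul_mem hf hg
      rwa [AddMonoidAlgebra.single_mul_single, mul_one] at this
    | single i b => exact hs i b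
  refine eq_top_iff.2 fun f _ => ?_
  induction f using AddMonoidAlgebra.induction_linear with
  | zero => exact zero_mem S
  | add f g hf hg => exact add_mem (hf trivial) (hg trivial)
  | single m c =>
    have := S.smul_mem (hm m) c
    rwa [AddMonoidAlgebra.smul_single, smul_eq_mul, mul_one] at this

/-- Evaluation of a Laurent polynomial at units. -/
def evalUnits {A : Type*} [CommRing A] [Algebra ℂ A] (u : σ → Aˣ) :
    MvLaurentPolynomial σ →ₐ[ℂ] A :=
  AddMonoidAlgebra.lift ℂ A (σ →₀ ℤ) ((Units.coeHom A).comp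
    (AddMonoidHom.toMultiplicativeLeft
      (Finsupp.liftAddHom fun i => zmultiplesHom (Additive Aˣ) (Additive.ofMul (u i)))))

@[simp] theorem evalUnits_X {A : Type*} [CommRing A] [Algebra ℂ A] (u : σ → Aˣ) (i : σ) :
    evalUnits u (X i) = u i := by
  rw [evalUnits, X, AddMonoidAlgebra.lift_single, one_smul]
  simp

theorem evalUnits_single_neg {A : Type*} [CommRing A] [Algebra ℂ A] (u : σ → Aˣ) (i : σ) :
    evalUnits u (AddMonoidAlgebra.single (Finsupp.single i (-1)) 1) = ((u i)⁻¹ : Aˣ) := by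
  rw [evalUnits, AddMonoidAlgebra.lift_single, one_smul]
  simp [-Finsupp.single_neg]

end MvLaurentPolynomial

/-! ## A spanning family -/

namespace TriangleRelations

variable {R : Type*} [CommRing R] {v : GridVar → R}

/-- The value of a variable, as a unit. -/
def unit (h : TriangleRelations v) (i : GridVar) : Rˣ := (h.isUnit i).unit

@[simp] theorem coe_unit (h : TriangleRelations v) (i : GridVar) : (h.unit i : R) = v i := rfl

/-- Generators of the algebra as a module over the Laurent polynomials in `x₁`, `x₂`. -/
def cell (v : GridVar → R) : Fin 6 → R := ![1, v .y₁, v .y₂, v .y₃, v .z, v .z * v .z]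

/-- The translates of the cells. -/
def family (h : TriangleRelations v) (i : Fin 6 × ℤ × ℤ) : R :=
  ↑(h.unit .x₁ ^ i.2.1 * h.unit .x₂ ^ i.2.2) * cell v i.1

theorem map {S : Type*} [CommRing S] (h : TriangleRelations v) (f : R →+* S) :
    TriangleRelations (f ∘ v) where
  isUnit_x₁ := h.isUnit_x₁.map f
  isUnit_x₂ := h.isUnit_x₂.map f
  y₁ := by simpa using congrArg f h.y₁
  y₂ := by simpa using congrArg f h.y₂
  y₃ := by simpa using congrArg f h.y₃
  z_y₃ := by simpa using congrArg f h.z_y₃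
  z_x₁_y₂ := by simpa using congrArg f h.z_x₁_y₂
  z_x₂_y₁ := by simpa using congrArg f h.z_x₂_y₁
  z_y₁_y₂ := by simpa using congrArg f h.z_y₁_y₂
  z_y₁_y₃ := by simpa using congrArg f h.z_y₁_y₃
  z_y₂_y₃ := by simpa using congrArg f h.z_y₂_y₃

/-- This carries linear combinations of the family from the abstract quotient to the Minkowski ring.
-/
theorem map_family {S : Type*} [CommRing S] (h : TriangleRelations v) (f : R →+* S)
    {w : GridVar → S} (h' : TriangleRelations w) (hw : ∀ i, f (v i) = w i)
    (i : Fin 6 × ℤ × ℤ) : f (h.family i) = h'.family i := by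
  have hu : ∀ i, Units.map (f : R →* S) (h.unit i) = h'.unit i := fun i => Units.ext (hw i)
  have hc : f (cell v i.1) = cell w i.1 := by
    obtain ⟨k, -⟩ := i
    fin_cases k <;> simp [cell, hw]
  rw [family, family, map_mul, hc, ← hu, ← hu, ← map_zpow, ← map_zpow, ← map_mul]
  rfl

/-! ### Stability of the span of the cells under all variables and their inverses -/

variable [Algebra ℂ R]

/-- The span of the translates of the cells. -/
def cellSpan (h : TriangleRelations v) : Submodule ℂ R := Submodule.span ℂ (Set.range h.family)

/-- The elements that map the span of the translates of the cells to itself. -/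
def stabilizer (h : TriangleRelations v) : Subalgebra ℂ R where
  carrier := {r | ∀ s ∈ h.cellSpan, r * s ∈ h.cellSpan}
  mul_mem' hr hs t ht := by
    rw [mul_assoc]
    exact hr _ (hs t ht)
  add_mem' hr hs t ht := by
    rw [add_mul]
    exact add_mem (hr t ht) (hs t ht)
  algebraMap_mem' c s hs := by
    rw [← Algebra.smul_def]
    exact h.cellSpan.smul_mem c hs

theorem mem_stabilizer_of_family (h : TriangleRelations v) {r : R}
    (hr : ∀ i, r * h.family i ∈ h.cellSpan) : r ∈ h.stabilizer := by
  intro s hs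
  induction hs using Submodule.span_induction with
  | mem s hs =>
    obtain ⟨i, rfl⟩ := hs
    exact hr i
  | zero => simp
  | add s t _ _ hs ht =>
    rw [mul_add]
    exact add_mem hs ht
  | smul c s _ hs =>
    rw [mul_smul_comm]
    exact h.cellSpan.smul_mem c hs

theorem family_mem (h : TriangleRelations v) (i : Fin 6 × ℤ × ℤ) : h.family i ∈ h.cellSpan :=
  Submodule.subset_span ⟨i, rfl⟩

theorem monomial_mem_stabilizer (h : TriangleRelations v) (m n : ℤ) :
    ((h.unit .x₁ ^ m * h.unit .x₂ ^ n : Rˣ) : R) ∈ h.stabilizer := by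
  refine h.mem_stabilizer_of_family fun i => ?_
  convert h.family_mem (i.1, m + i.2.1, n + i.2.2) using 1
  simp only [family, zpow_add]
  push_cast
  ring

theorem x₁_mem (h : TriangleRelations v) : v .x₁ ∈ h.stabilizer := by
  simpa using h.monomial_mem_stabilizer 1 0

theorem x₂_mem (h : TriangleRelations v) : v .x₂ ∈ h.stabilizer := by
  simpa using h.monomial_mem_stabilizer 0 1

theorem inv_x₁_mem (h : TriangleRelations v) : ((h.unit .x₁)⁻¹ : Rˣ).val ∈ h.stabilizer := by
  simpa using h.monomial_mem_stabilizer (-1) 0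

theorem inv_x₂_mem (h : TriangleRelations v) : ((h.unit .x₂)⁻¹ : Rˣ).val ∈ h.stabilizer := by
  simpa using h.monomial_mem_stabilizer 0 (-1)

theorem cell_mem (h : TriangleRelations v) (k : Fin 6) : cell v k ∈ h.cellSpan := by
  simpa [family] using h.family_mem (k, 0, 0)

/-- An element lies in the stabilizer as soon as its products with the cells are combinations of
the cells whose coefficients stabilize the span. -/
theorem mem_stabilizer_of_cell (h : TriangleRelations v) {r : R} (c : Fin 6 → Fin 6 → R)
    (hc : ∀ k l, c k l ∈ h.stabilizer) (hr : ∀ k, r * cell v k = ∑ l, c k l * cell v l) :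
    r ∈ h.stabilizer := by
  refine h.mem_stabilizer_of_family fun i => ?_
  rw [family, mul_left_comm, hr]
  exact h.monomial_mem_stabilizer _ _ _
    (sum_mem fun l _ => hc i.1 l _ (h.cell_mem l))

theorem z_mem (h : TriangleRelations v) : v .z ∈ h.stabilizer := by
  have h₁ := h.x₁_mem
  have h₂ := h.x₂_mem
  have h₃ := add_mem (add_mem h₁ h₂) (mul_mem h₁ h₂)
  -- Row `k` expands `z * cell v k` in the cells: each product of `z` with some `y` is resolved by a
  -- quadratic relation, and `z³` by `z_cubic`.
  refine h.mem_stabilizer_of_cell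
    ![![0, 0, 0, 0, 1, 0],
      ![0, v .x₂, 0, 0, -v .x₂, 1],
      ![0, 0, v .x₁, 0, -v .x₁, 1],
      ![0, 0, 0, 1, -1, 1],
      ![0, 0, 0, 0, 0, 1],
      ![v .x₁ * v .x₂, 0, 0, 0, -(v .x₁ + v .x₂ + v .x₁ * v .x₂), 1 + v .x₁ + v .x₂]] ?_ ?_
  · intro k l
    fin_cases k <;> fin_cases l <;>
      simp [-neg_add_rev, zero_mem, one_mem, add_mem, mul_mem, h₁, h₂, h₃]
  · intro k
    fin_cases k <;> simp [cell, Fin.sum_univ_six]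
    · linear_combination -h.z_x₂_y₁
    · linear_combination -h.z_x₁_y₂
    · linear_combination -h.z_y₃
    · linear_combination h.z_cubic

theorem y₁_mem (h : TriangleRelations v) : v .y₁ ∈ h.stabilizer := by
  have h₁ := h.x₁_mem
  have h₂ := h.x₂_mem
  have h₃ := add_mem (add_mem h₁ h₂) (mul_mem h₁ h₂)
  -- A product of two different `y`'s is reduced to their products with `z` and to `z²`. The last
  -- row applies the expansion of `z * y₁` twice and then `z_cubic`.
  refine h.mem_stabilizer_of_cell
    ![![0, 1, 0, 0, 0, 0],
      ![-v .x₁, 1 + v .x₁, 0, 0, 0, 0],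
      ![0, v .x₂, v .x₁, 0, -(v .x₁ + v .x₂), 1],
      ![0, v .x₂, 0, 1, -(1 + v .x₂), 1],
      ![0, v .x₂, 0, 0, -v .x₂, 1],
      ![v .x₁ * v .x₂, v .x₂ * v .x₂, 0, 0, -(v .x₁ + v .x₂ + v .x₁ * v .x₂ + v .x₂ * v .x₂),
        1 + v .x₁ + v .x₂]] ?_ ?_
  · intro k l
    fin_cases k <;> fin_cases l <;>
      simp [-neg_add_rev, zero_mem, one_mem, add_mem, mul_mem, h₁, h₂, h₃]
  · intro k
    fin_cases k <;> simp [cell, Fin.sum_univ_six]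
    · linear_combination h.y₁
    · linear_combination h.z_y₁_y₂ - h.z_x₂_y₁ - h.z_x₁_y₂
    · linear_combination h.z_y₁_y₃ - h.z_x₂_y₁ - h.z_y₃
    · linear_combination -h.z_x₂_y₁
    · linear_combination h.z_cubic - (v .z + v .x₂) * h.z_x₂_y₁

theorem y₂_mem (h : TriangleRelations v) : v .y₂ ∈ h.stabilizer := by
  have h₁ := h.x₁_mem
  have h₂ := h.x₂_mem
  have h₃ := add_mem (add_mem h₁ h₂) (mul_mem h₁ h₂)
  refine h.mem_stabilizer_of_cell
    ![![0, 0, 1, 0, 0, 0],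
      ![0, v .x₂, v .x₁, 0, -(v .x₁ + v .x₂), 1],
      ![-v .x₂, 0, 1 + v .x₂, 0, 0, 0],
      ![0, 0, v .x₁, 1, -(1 + v .x₁), 1],
      ![0, 0, v .x₁, 0, -v .x₁, 1],
      ![v .x₁ * v .x₂, 0, v .x₁ * v .x₁, 0, -(v .x₁ + v .x₂ + v .x₁ * v .x₂ + v .x₁ * v .x₁),
        1 + v .x₁ + v .x₂]] ?_ ?_
  · intro k l
    fin_cases k <;> fin_cases l <;>
      simp [-neg_add_rev, zero_mem, one_mem, add_mem, mul_mem, h₁, h₂, h₃]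
  · intro k
    fin_cases k <;> simp [cell, Fin.sum_univ_six]
    · linear_combination h.z_y₁_y₂ - h.z_x₂_y₁ - h.z_x₁_y₂
    · linear_combination h.y₂
    · linear_combination h.z_y₂_y₃ - h.z_x₁_y₂ - h.z_y₃
    · linear_combination -h.z_x₁_y₂
    · linear_combination h.z_cubic - (v .z + v .x₁) * h.z_x₁_y₂

theorem y₃_mem (h : TriangleRelations v) : v .y₃ ∈ h.stabilizer := by
  have h₁ := h.x₁_mem
  have h₂ := h.x₂_mem
  have h₃ := add_mem (add_mem h₁ h₂) (mul_mem h₁ h₂)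
  refine h.mem_stabilizer_of_cell
    ![![0, 0, 0, 1, 0, 0],
      ![0, v .x₂, 0, 1, -(1 + v .x₂), 1],
      ![0, 0, v .x₁, 1, -(1 + v .x₁), 1],
      ![-(v .x₁ * v .x₂), 0, 0, v .x₁ + v .x₂, 0, 0],
      ![0, 0, 0, 1, -1, 1],
      ![v .x₁ * v .x₂, 0, 0, 1, -(v .x₁ + v .x₂ + v .x₁ * v .x₂ + 1), 1 + v .x₁ + v .x₂]] ?_ ?_
  · intro k l
    fin_cases k <;> fin_cases l <;>
      simp [-neg_add_rev, zero_mem, one_mem, add_mem, mul_mem, h₁, h₂, h₃]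
  · intro k
    fin_cases k <;> simp [cell, Fin.sum_univ_six]
    · linear_combination h.z_y₁_y₃ - h.z_x₂_y₁ - h.z_y₃
    · linear_combination h.z_y₂_y₃ - h.z_x₁_y₂ - h.z_y₃
    · linear_combination h.y₃
    · linear_combination -h.z_y₃
    · linear_combination h.z_cubic - (v .z + 1) * h.z_y₃

theorem var_mem (h : TriangleRelations v) (i : GridVar) : v i ∈ h.stabilizer := by
  cases i
  exacts [h.x₁_mem, h.x₂_mem, h.y₁_mem, h.y₂_mem, h.y₃_mem, h.z_mem]

/-- The identities `y₁_mul`, `y₂_mul`, `y₃_mul` and `z_mul` exhibit each inverse as a polynomial in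
the variables times inverses of `x₁`, `x₂`. -/
theorem inv_var_mem (h : TriangleRelations v) (i : GridVar) :
    ((h.unit i)⁻¹ : Rˣ).val ∈ h.stabilizer := by
  have key : ∀ {i : GridVar} {r s : R}, r ∈ h.stabilizer → s ∈ h.stabilizer →
      v i * r * s = 1 → ((h.unit i)⁻¹ : Rˣ).val ∈ h.stabilizer := by
    intro i r s hr hs hrs
    rw [Units.inv_eq_of_mul_eq_one_right (a := r * s) (by rw [coe_unit, ← mul_assoc, hrs])]
    exact mul_mem hr hs
  have hx₁ : v .x₁ * ((h.unit .x₁)⁻¹ : Rˣ).val = 1 := (h.unit .x₁).mul_inv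
  have hx₂ : v .x₂ * ((h.unit .x₂)⁻¹ : Rˣ).val = 1 := (h.unit .x₂).mul_inv
  have hx : v .x₁ * v .x₂ * (((h.unit .x₁)⁻¹ : Rˣ).val * ((h.unit .x₂)⁻¹ : Rˣ).val) = 1 := by
    rw [mul_mul_mul_comm, hx₁, hx₂, one_mul]
  have h₁ := h.x₁_mem
  have h₂ := h.x₂_mem
  cases i
  · exact h.inv_x₁_mem
  · exact h.inv_x₂_mem
  · exact key (sub_mem (add_mem (one_mem _) h₁) h.y₁_mem) h.inv_x₁_mem (by rw [h.y₁_mul, hx₁])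
  · exact key (sub_mem (add_mem (one_mem _) h₂) h.y₂_mem) h.inv_x₂_mem (by rw [h.y₂_mul, hx₂])
  · exact key (sub_mem (add_mem h₁ h₂) h.y₃_mem) (mul_mem h.inv_x₁_mem h.inv_x₂_mem)
      (by rw [h.y₃_mul, hx])
  · exact key (add_mem (sub_mem (pow_mem h.z_mem 2)
        (mul_mem (add_mem (add_mem (one_mem _) h₁) h₂) h.z_mem))
        (add_mem (add_mem h₁ h₂) (mul_mem h₁ h₂))) (mul_mem h.inv_x₁_mem h.inv_x₂_mem)
      (by rw [h.z_mul, hx])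

/-- By surjectivity the variables and their inverses generate the algebra, so everything stabilizes
the span, which contains `1`. -/
theorem cellSpan_eq_top (h : TriangleRelations v)
    (hv : Function.Surjective (MvLaurentPolynomial.evalUnits h.unit)) : h.cellSpan = ⊤ := by
  have hS : h.stabilizer.comap (MvLaurentPolynomial.evalUnits h.unit) = ⊤ := by
    apply MvLaurentPolynomial.subalgebra_eq_top
    · intro i
      simpa using h.var_mem i
    · intro i
      rw [Subalgebra.mem_comap, MvLaurentPolynomial.evalUnits_single_neg]
      exact h.inv_var_mem i
  refine eq_top_iff.2 fun r _ => ?_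
  obtain ⟨f, rfl⟩ := hv r
  have hf : f ∈ h.stabilizer.comap (MvLaurentPolynomial.evalUnits h.unit) := hS ▸ trivial
  have := hf 1 (h.cell_mem 0)
  rwa [mul_one] at this

end TriangleRelations

end
noncomputable section

/-! ## Linear independence -/

/-- Functions that are triangular with respect to a family of points are linearly independent. -/
theorem linearIndependent_of_triangular {ι X : Type*} (f : ι → X → ℂ) (pt : ι → X) (rk : ι → ℕ)
    (h₁ : ∀ i, f i (pt i) ≠ 0) (h₂ : ∀ i j, f j (pt i) ≠ 0 → j = i ∨ rk j < rk i) :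
    LinearIndependent ℂ f := by
  rw [linearIndependent_iff]
  intro l hl
  have key : ∀ n i, rk i = n → l i = 0 := by
    intro n
    induction n using Nat.strong_induction_on with
    | _ n ih =>
      intro i hi
      have h := congrFun hl (pt i)
      rw [Finsupp.linearCombination_apply, Finsupp.sum, Finset.sum_apply, Pi.zero_apply,
        Finset.sum_eq_single i] at h
      · simpa [h₁] using h
      · intro j _ hj
        rw [Pi.smul_apply, smul_eq_mul]
        by_contra hne
        -- A term surviving at `pt i` has smaller rank, so its coefficient is already known to
        -- vanish.
        rcases h₂ i j (right_ne_zero_of_mul hne) with h | h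
        · exact hj h
        · exact left_ne_zero_of_mul hne (ih _ (hi ▸ h) j rfl)
      · intro hi
        simp [Finsupp.notMem_support_iff.1 hi]
  ext i
  exact key _ i rfl

/-- Denominator `6` accommodates both midpoints of edges and centroids of triangles, and turns
membership into integer inequalities. -/
theorem latticePoint_div_mem_hexagonSet {p : Fin 6 → ℤ} {i j : ℤ} :
    latticePoint ((i : ℝ) / 6) ((j : ℝ) / 6) ∈ hexagonSet p ↔
      (6 * p 0 ≤ i ∧ i ≤ 6 * p 1) ∧ (6 * p 2 ≤ j ∧ j ≤ 6 * p 3) ∧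
        (6 * p 4 ≤ i + j ∧ i + j ≤ 6 * p 5) := by
  rw [mem_hexagonSet, latticeFst_latticePoint, latticeSnd_latticePoint, ← add_div,
    le_div_iff₀ (by norm_num), le_div_iff₀ (by norm_num), le_div_iff₀ (by norm_num),
    div_le_iff₀ (by norm_num), div_le_iff₀ (by norm_num), div_le_iff₀ (by norm_num)]
  norm_cast
  simp only [mul_comm _ (6 : ℤ)]

/-- Bounds for the cells. -/
def cellBounds : Fin 6 → Fin 6 → ℤ :=
  ![0, faceBounds .y₁, faceBounds .y₂, faceBounds .y₃, faceBounds .z,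
    faceBounds .z + faceBounds .z]

/-- Bounds for a point of the lattice. -/
def pointBounds (m n : ℤ) : Fin 6 → ℤ := ![m, m, n, n, m + n, m + n]

theorem pointBounds_mem (m n : ℤ) : pointBounds m n ∈ tightBounds := by
  simp [mem_tightBounds, pointBounds]

theorem pointBounds_add (m n m' n' : ℤ) :
    pointBounds m n + pointBounds m' n' = pointBounds (m + m') (n + n') := by
  ext i
  fin_cases i <;> simp [pointBounds] <;> ring

/-- The indicator function of a lattice point. -/
def indPoint : Multiplicative (ℤ × ℤ) →* MinkowskiRing 2 where
  toFun a := MinkowskiRing.ind (hexagon (pointBounds a.toAdd.1 a.toAdd.2))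
  map_one' := by
    rw [← MinkowskiRing.ind_zero, ← hexagon_zero]
    congr 2
    ext i
    fin_cases i <;> simp [pointBounds]
  map_mul' a b := by
    rw [MinkowskiRing.ind_mul_ind, hexagon_add (pointBounds_mem _ _) (pointBounds_mem _ _),
      pointBounds_add]
    rfl

theorem coe_unit_zpow_mul_zpow (m n : ℤ) :
    ((triangleRelations_indFace.unit .x₁ ^ m * triangleRelations_indFace.unit .x₂ ^ n :
      (MinkowskiRing 2)ˣ) : MinkowskiRing 2) = indPoint (.ofAdd (m, n)) := by
  have h : ∀ (i : GridVar) (a : ℤ × ℤ), indFace i = indPoint (.ofAdd a) → ∀ m : ℤ,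
      ((triangleRelations_indFace.unit i ^ m : (MinkowskiRing 2)ˣ) : MinkowskiRing 2) =
        indPoint (.ofAdd (m • a)) := by
    intro i a ha m
    -- A homomorphism from a group takes values in units, so integer powers can be computed in the
    -- group of translations.
    have hu : triangleRelations_indFace.unit i = indPoint.toHomUnits (.ofAdd a) :=
      Units.ext ha
    rw [hu, ← map_zpow, ofAdd_zsmul]
    rfl
  rw [Units.val_mul, h .x₁ (1, 0), h .x₂ (0, 1), ← map_mul, ← ofAdd_add]
  · simp
  · rw [indFace, gridFace_eq_hexagon]
    rfl
  · rw [indFace, gridFace_eq_hexagon]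
    rfl

theorem cellBounds_mem (k : Fin 6) : cellBounds k ∈ tightBounds := by
  fin_cases k
  exacts [zero_mem _, faceBounds_mem .y₁, faceBounds_mem .y₂, faceBounds_mem .y₃, faceBounds_mem .z,
    add_mem (faceBounds_mem .z) (faceBounds_mem .z)]

theorem cell_indFace (k : Fin 6) :
    TriangleRelations.cell indFace k = MinkowskiRing.ind (hexagon (cellBounds k)) := by
  fin_cases k <;> simp [TriangleRelations.cell, cellBounds, indFace, gridFace_eq_hexagon]
  · rw [hexagon_zero, MinkowskiRing.ind_zero]
  · rw [MinkowskiRing.ind_mul_ind, hexagon_add (faceBounds_mem _) (faceBounds_mem _)]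

theorem family_indFace (i : Fin 6 × ℤ × ℤ) :
    triangleRelations_indFace.family i =
      MinkowskiRing.ind (hexagon (pointBounds i.2.1 i.2.2 + cellBounds i.1)) := by
  rw [TriangleRelations.family, coe_unit_zpow_mul_zpow, cell_indFace,
    ← hexagon_add (pointBounds_mem _ _) (cellBounds_mem _), ← MinkowskiRing.ind_mul_ind]
  rfl

theorem linearIndependent_family : LinearIndependent ℂ triangleRelations_indFace.family := by
  refine LinearIndependent.of_comp MinkowskiRing.toFun ?_
  -- In sixths, these are the vertex `O`, the midpoints of the three edges, the centroid of `OAB`,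
  -- and the centroid of the downward triangle in the middle of `2 OAB`.
  let α : Fin 6 → ℤ := ![0, 3, 0, 3, 2, 4]
  let β : Fin 6 → ℤ := ![0, 0, 3, 3, 2, 4]
  have hmem : ∀ i j : Fin 6 × ℤ × ℤ,
      (MinkowskiRing.toFun ∘ triangleRelations_indFace.family) j
        (latticePoint (((6 * i.2.1 + α i.1 : ℤ) : ℝ) / 6) (((6 * i.2.2 + β i.1 : ℤ) : ℝ) / 6)) ≠ 0
      ↔ latticePoint (((6 * i.2.1 + α i.1 : ℤ) : ℝ) / 6) (((6 * i.2.2 + β i.1 : ℤ) : ℝ) / 6) ∈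
        hexagonSet (pointBounds j.2.1 j.2.2 + cellBounds j.1) := by
    intro i j
    rw [Function.comp_apply, family_indFace, MinkowskiRing.toFun_ind, coe_hexagon]
    simp
  -- Only one translate of the doubled triangle contains the centroid of a given downward triangle,
  -- so `z²` has rank `0`. Upward centroids lie otherwise only in doubled triangles, edge midpoints
  -- otherwise only in triangles and doubled triangles, and vertices come last.
  refine linearIndependent_of_triangular _
    (fun i => latticePoint (((6 * i.2.1 + α i.1 : ℤ) : ℝ) / 6)
      (((6 * i.2.2 + β i.1 : ℤ) : ℝ) / 6)) (fun i => ![3, 2, 2, 2, 1, 0] i.1) ?_ ?_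
  · rintro ⟨k, m, n⟩
    rw [hmem, latticePoint_div_mem_hexagonSet]
    fin_cases k <;> simp [α, β, pointBounds, cellBounds, faceBounds] <;> omega
  · rintro ⟨k, m, n⟩ ⟨k', m', n'⟩
    rw [hmem, latticePoint_div_mem_hexagonSet]
    fin_cases k <;> fin_cases k' <;>
      simp [α, β, pointBounds, cellBounds, faceBounds, -not_and, -and_imp] <;> omega

/-! ## The presentation -/

open MvLaurentPolynomial

/-- The ideal of relations between the faces of the triangle. -/
abbrev relationIdeal : Ideal (MvLaurentPolynomial GridVar) :=
  Ideal.span (relationsG₁ ∪ relationsG₂)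

theorem triangleRelations_mk :
    TriangleRelations fun i : GridVar => Ideal.Quotient.mk relationIdeal (X i) := by
  have key : ∀ f ∈ relationsG₁ ∪ relationsG₂, Ideal.Quotient.mk relationIdeal f = 0 :=
    fun f hf => Ideal.Quotient.eq_zero_iff_mem.2 (Ideal.subset_span hf)
  simp only [relationsG₁, relationsG₂, Set.mem_union, Set.mem_insert_iff, Set.mem_singleton_iff,
    or_imp, forall_and, forall_eq, map_mul, map_sub, map_one] at key
  obtain ⟨⟨h₁, h₂, h₃⟩, h₄, h₅, h₆, h₇, h₈, h₉⟩ := key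
  exact ⟨(isUnit_X _).map _, (isUnit_X _).map _, h₁, h₂, h₃, h₄, h₅, h₆, h₇, h₈, h₉⟩

theorem evalUnits_indFace_eq_zero (f : MvLaurentPolynomial GridVar) (hf : f ∈ relationIdeal) :
    evalUnits triangleRelations_indFace.unit f = 0 := by
  have h := triangleRelations_indFace
  have : relationIdeal ≤ RingHom.ker (evalUnits triangleRelations_indFace.unit) := by
    rw [Ideal.span_le]
    intro f hf
    simp only [relationsG₁, relationsG₂, Set.mem_union, Set.mem_insert_iff,
      Set.mem_singleton_iff] at hf
    rw [SetLike.mem_coe, RingHom.mem_ker]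
    rcases hf with (rfl | rfl | rfl) | rfl | rfl | rfl | rfl | rfl | rfl <;>
      simp only [map_mul, map_sub, map_one, evalUnits_X, TriangleRelations.coe_unit]
    exacts [h.y₁, h.y₂, h.y₃, h.z_y₃, h.z_x₁_y₂, h.z_x₂_y₁, h.z_y₁_y₂, h.z_y₁_y₃, h.z_y₂_y₃]
  exact this hf

/-- The map from the abstract presentation to the Minkowski ring. -/
def presentation : (MvLaurentPolynomial GridVar ⧸ relationIdeal) →ₐ[ℂ] MinkowskiRing 2 :=
  Ideal.Quotient.liftₐ _ (evalUnits triangleRelations_indFace.unit) evalUnits_indFace_eq_zero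

theorem presentation_mk (f : MvLaurentPolynomial GridVar) :
    presentation (Ideal.Quotient.mk relationIdeal f) =
      evalUnits triangleRelations_indFace.unit f := rfl

theorem presentation_mk_X (i : GridVar) :
    presentation (Ideal.Quotient.mk relationIdeal (X i)) = indFace i := by
  rw [presentation_mk, evalUnits_X, TriangleRelations.coe_unit]

theorem evalUnits_eq_mk (f : MvLaurentPolynomial GridVar) :
    evalUnits triangleRelations_mk.unit f = Ideal.Quotient.mk relationIdeal f := by
  have h : AlgHom.equalizer (evalUnits triangleRelations_mk.unit)
      (Ideal.Quotient.mkₐ ℂ relationIdeal) = ⊤ := by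
    apply subalgebra_eq_top
    · intro i
      rw [AlgHom.mem_equalizer, evalUnits_X]
      rfl
    · intro i
      rw [AlgHom.mem_equalizer, evalUnits_single_neg]
      refine Units.inv_eq_of_mul_eq_one_left ?_
      have := congrArg (Ideal.Quotient.mk relationIdeal) (single_mul_X i)
      rwa [map_mul, map_one] at this
  have hf : f ∈ AlgHom.equalizer (evalUnits triangleRelations_mk.unit)
      (Ideal.Quotient.mkₐ ℂ relationIdeal) := h ▸ trivial
  exact hf

/-- The family spans the quotient and has linearly independent image, so an element of the kernel
has only zero coefficients. -/
theorem presentation_injective : Function.Injective presentation := by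
  have hsurj : Function.Surjective (evalUnits triangleRelations_mk.unit) := by
    intro r
    obtain ⟨f, rfl⟩ := Ideal.Quotient.mk_surjective r
    exact ⟨f, evalUnits_eq_mk f⟩
  have hspan := triangleRelations_mk.cellSpan_eq_top hsurj
  rw [injective_iff_map_eq_zero]
  intro r hr
  have hr' : r ∈ triangleRelations_mk.cellSpan := hspan ▸ trivial
  rw [TriangleRelations.cellSpan, Finsupp.mem_span_range_iff_exists_finsupp] at hr'
  obtain ⟨c, rfl⟩ := hr'
  have h : Finsupp.linearCombination ℂ triangleRelations_indFace.family c = 0 := by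
    rw [← hr, Finsupp.linearCombination_apply, map_finsuppSum]
    refine Finsupp.sum_congr fun i _ => ?_
    rw [map_smul]
    exact congrArg _ (triangleRelations_mk.map_family presentation.toRingHom
      triangleRelations_indFace presentation_mk_X i).symm
  rw [linearIndependent_iff.1 linearIndependent_family c h, Finsupp.sum_zero_index]

/-! ### The image of the presentation -/

theorem range_presentation_le :
    presentation.range ≤ laurentMinkowskiRing (Set.range gridFace) := by
  have h : (laurentMinkowskiRing (Set.range gridFace)).comap
      (evalUnits triangleRelations_indFace.unit) = ⊤ := by
    apply subalgebra_eq_top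
    · intro i
      rw [Subalgebra.mem_comap, evalUnits_X]
      exact Algebra.subset_adjoin (Or.inl ⟨gridFace i, ⟨i, rfl⟩, rfl⟩)
    · intro i
      rw [Subalgebra.mem_comap, evalUnits_single_neg]
      exact Algebra.subset_adjoin
        (Or.inr ⟨gridFace i, ⟨i, rfl⟩, (triangleRelations_indFace.unit i).mul_inv⟩)
  rintro _ ⟨r, rfl⟩
  obtain ⟨f, rfl⟩ := Ideal.Quotient.mk_surjective r
  have hf : f ∈ (laurentMinkowskiRing (Set.range gridFace)).comap
      (evalUnits triangleRelations_indFace.unit) := h ▸ trivial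
  exact hf

theorem laurentMinkowskiRing_gridPolygons_le :
    laurentMinkowskiRing gridPolygons ≤ presentation.range := by
  -- Taking images of units, rather than the whole range, makes `G` closed under cancellation and so
  -- provides the inverses as well.
  let G : Submonoid (MinkowskiRing 2) :=
    (IsUnit.submonoid (MvLaurentPolynomial GridVar ⧸ relationIdeal)).map
      (presentation : _ →* MinkowskiRing 2)
  have hG : ∀ i, indFace i ∈ G := fun i => ⟨_, triangleRelations_mk.isUnit i, presentation_mk_X i⟩
  have hG' : ∀ u v, v ∈ G → u * v ∈ G → u ∈ G := by
    rintro u _ ⟨_, ⟨a, rfl⟩, rfl⟩ ⟨_, ⟨b, rfl⟩, hb⟩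
    refine ⟨_, (b * a⁻¹).isUnit, ?_⟩
    have ha : presentation (a : MvLaurentPolynomial GridVar ⧸ relationIdeal) *
        presentation (a⁻¹ : (MvLaurentPolynomial GridVar ⧸ relationIdeal)ˣ).val = 1 := by
      rw [← map_mul, Units.mul_inv, map_one]
    change presentation _ = u * presentation _ at hb
    change presentation _ = u
    rw [Units.val_mul, map_mul, hb, mul_assoc, ha, mul_one]
  have key : ∀ P ∈ gridPolygons, MinkowskiRing.ind P ∈ G :=
    fun P hP => ind_mem_units_of_faces hG hG' hP
  refine Algebra.adjoin_le ?_
  rintro m (⟨P, hP, rfl⟩ | ⟨P, hP, hm⟩)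
  · obtain ⟨r, -, hr⟩ := key P hP
    exact ⟨r, hr⟩
  · obtain ⟨_, -, hr⟩ := hG' m _ (key P hP) (by rw [mul_comm, hm]; exact one_mem G)
    exact ⟨_, hr⟩

theorem laurentMinkowskiRing_mono {d : ℕ} {D E : Set (polyhedra d)} (h : D ⊆ E) :
    laurentMinkowskiRing D ≤ laurentMinkowskiRing E :=
  Algebra.adjoin_mono (Set.union_subset_union (Set.image_mono h)
    fun _ ⟨P, hP, hm⟩ => ⟨P, h hP, hm⟩)

theorem range_gridFace_subset : Set.range gridFace ⊆ gridPolygons := by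
  rintro _ ⟨i, rfl⟩
  exact gridFace_mem_gridPolygons i

end
theorem mainTheorem2 :
    laurentMinkowskiRing gridPolygons = laurentMinkowskiRing (Set.range gridFace) ∧
    ∃ e : (MvLaurentPolynomial GridVar ⧸ Ideal.span (relationsG₁ ∪ relationsG₂)) ≃ₐ[ℂ]
        laurentMinkowskiRing gridPolygons,
      ∀ i : GridVar,
        (e (Ideal.Quotient.mk (Ideal.span (relationsG₁ ∪ relationsG₂))
            (MvLaurentPolynomial.X i)) : MinkowskiRing 2) =
          MinkowskiRing.ind (gridFace i) := by
  have h₁ := laurentMinkowskiRing_mono range_gridFace_subset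
  have h₂ := laurentMinkowskiRing_gridPolygons_le
  have h₃ := range_presentation_le
  -- The three inclusions form a cycle, so both Laurent Minkowski rings equal the range of
  -- `presentation`.
  refine ⟨le_antisymm (h₂.trans h₃) h₁,
    (AlgEquiv.ofInjective presentation presentation_injective).trans
      (Subalgebra.equivOfEq _ _ (le_antisymm (h₃.trans h₁) h₂)), fun i => ?_⟩
  exact presentation_mk_X i
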